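/- Let $n\ge 1$ and let $(M^{2n},\omega,\theta)$ be a locally conformal symplectic manifold: $M$ is a smooth $2n$-manifold, $\omega$ a smooth non-degenerate 2-form and $\theta$ a smooth closed 1-form with $d\omega=-\omega\wedge\theta$. Let $\Omega^k=\Omega^k(M)$ be the smooth $k$-forms ($\Omega^k=0$ for $k<0$), $\Omega^*=\bigoplus_k\Omega^k$, $L\alpha=\omega\wedge\alpha$, and for $l\in\mathbb Z$ let $d_l\alpha=d\alpha+l\,\theta\wedge\alpha$. Then $d_l^2=0$ and $d_lL=Ld_{l-1}$. Put $$H^k_l=H^k_l(M)=\frac{\ker d_l\cap\Omega^k}{d_l\Omega^{k-1}} .$$ Let $\mathcal P^k=\{\alpha\in\Omega^k: L^{n-k+1}\alpha=0\}$ for $0\le k\le n$, $\mathcal P^k=0$ otherwise, $\mathcal P^*=\bigoplus_k\mathcal P^k$, and let $\Pi_{pr}:\Omega^*=\mathcal P^*\oplus L\Omega^*\to\mathcal P^*$ be the Lefschetz projection. Put $d_l^+=\Pi_{pr}d_l$ and let $d_l^-:\Omega^k\to\Omega^{k-1}$ ($0\le k\le n$) be the operator determined by $d_l=d_l^++Ld_l^-$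 (recall that $L$ is injective on $\Omega^{j}$ for $j\le n-1$). For $0\le k\le n$ put $$C^k_l=\frac{\ker d_l^-\cap\Omega^k}{d_l\Omega^{k-1}} .$$ Let $E^{p,q}_{k,r}$ be the spectral sequence of the complex $(\Omega^*,d_k)$ filtered by $F^p=L^p\Omega^*$ ($F^p=\Omega^*$ for $p\le 0$); thus $E^{p,q}_{k,1}=Z^{p,q}/(F^{p+1}\Omega^{p+q}+d_kF^p\Omega^{p+q-1})$ with $F^p\Omega^{m}=F^p\cap\Omega^m$ and $Z^{p,q}=\{a\in F^p\Omega^{p+q}: d_ka\in F^{p+1}\}$. Let $l\in\mathbb Z$ and $0\le p\le n-1$. The following maps are well defined, linear, and determined by the given formulas: * $\bar L:H^{k}_{l-1}\to H^{k+2}_l$, $[\alpha]\mapsto[L\alpha]$, and $\bar L^p:H^{k}_l\to E^{p,p+k}_{l+p,1}$, $[\alpha]\mapsto[L^p\alpha]$, for all $k\in\mathbb Z$; * for $p\le q\le n-1$: $\delta_{p,q}:E^{p,q}_{l+p,1}\to H^{q-(p+1)}_{l-1}$, $[L^p\alpha]\mapsto[d_l^-\alpha]$ for $\alpha\in\mathcal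 P^{q-p}$ with $d_l^+\alpha=0$ (every class has such a representative $L^p\alpha$); * $[L]:H^{n-(p+2)}_{l-1}\to C^{n-p}_l$, $[\alpha]\mapsto[L\alpha]$; * $[L^p]:C^{n-p}_l\to E^{p,n}_{l+p,1}$, $[\alpha]\mapsto[L^p\,\Pi_{pr}\alpha]$; * $\delta_{p,n}:E^{p,n}_{l+p,1}\to C^{n-(p+1)}_{l-1}$, $[L^p\alpha]\mapsto[d_l^-\alpha]$ for $\alpha\in\mathcal P^{n-p}$ (every class has such a representative $L^p\alpha$); * $[L^{p+1}]:C^{n-(p+1)}_{l-1}\to H^{n+p+1}_{l+p}$, $[\alpha]\mapsto[L^{p+1}\alpha]$. With these maps the long sequence $$\cdots\to H^{q-p}_l\xrightarrow{\bar L^p}E^{p,q}_{l+p,1}\xrightarrow{\delta_{p,q}}H^{q-(p+1)}_{l-1}\xrightarrow{\bar L}H^{q+1-p}_l\xrightarrow{\bar L^p}E^{p,q+1}_{l+p,1}\to\cdots\qquad(p\le q\le n-1)$$ is exact at $E^{p,q}_{l+p,1}$ and at $H^{q-(p+1)}_{l-1}$ for $p\le q\le n-1$, and at $H^{q-p}_l$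 for $p\le q\le n$, and it can be extended through $q=n$: the sequence $$E^{p,n-1}_{l+p,1}\xrightarrow{\delta_{p,n-1}}H^{n-(p+2)}_{l-1}\xrightarrow{[L]}C^{n-p}_l\xrightarrow{[L^p]}E^{p,n}_{l+p,1}\xrightarrow{\delta_{p,n}}C^{n-(p+1)}_{l-1}\xrightarrow{[L^{p+1}]}H^{n+p+1}_{l+p}\to 0$$ is exact. -/

import Mathlib

open scoped Manifold Topology

noncomputable section

namespace LCS

section Linear
variable {V : Type*} [NormedAddCommGroup V] [NormedSpace ℝ V]

/-- The exterior product `θ ∧ α` of a covector with a `k`-form, as a bilinear map. -/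
def wedgeOneL (V : Type*) [NormedAddCommGroup V] [NormedSpace ℝ V] (k : ℕ) :
    (V [⋀^Fin 1]→L[ℝ] ℝ) →L[ℝ] (V [⋀^Fin k]→L[ℝ] ℝ) →L[ℝ] (V [⋀^Fin (k + 1)]→L[ℝ] ℝ) :=
  (ContinuousLinearMap.compL ℝ _ _ _
      (ContinuousAlternatingMap.alternatizeUncurryFinCLM ℝ V ℝ)) ∘L
    (ContinuousLinearMap.smulRightL ℝ V (V [⋀^Fin k]→L[ℝ] ℝ)) ∘L
    ((ContinuousAlternatingMap.ofSubsingletonLIE (𝕜 := ℝ) (E := V) (F := ℝ)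
      (0 : Fin 1)).symm.toContinuousLinearEquiv : (V [⋀^Fin 1]→L[ℝ] ℝ) →L[ℝ] (V →L[ℝ] ℝ))

theorem wedgeOneL_apply {k : ℕ} (θ : V [⋀^Fin 1]→L[ℝ] ℝ) (α : V [⋀^Fin k]→L[ℝ] ℝ)
    (v : Fin (k + 1) → V) :
    wedgeOneL V k θ α v = ∑ i : Fin (k + 1), (-1) ^ (i : ℕ) * (θ ![v i] * α (i.removeNth v)) := by
  have h : ∀ x : V, (fun _ : Fin 1 => x) = ![x] := fun x => by ext i; simp
  simp [wedgeOneL, ContinuousAlternatingMap.alternatizeUncurryFin_apply, h]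

/-- The exterior product `ω ∧ α` of a `2`-form with a `k`-form, as a bilinear map:
`ω ∧ α = ½ ∑ eⁱ ∧ (ι_{eᵢ} ω) ∧ α`. -/
def wedgeTwoL (V : Type*) [NormedAddCommGroup V] [NormedSpace ℝ V] (k : ℕ) :
    (V [⋀^Fin 2]→L[ℝ] ℝ) →L[ℝ] (V [⋀^Fin k]→L[ℝ] ℝ) →L[ℝ] (V [⋀^Fin (k + 2)]→L[ℝ] ℝ) :=
  ContinuousLinearMap.flip <|
    (1 / 2 : ℝ) • (ContinuousLinearMap.precomp _
        (ContinuousAlternatingMap.curryLeftLI (𝕜 := ℝ) (E := V) (F := ℝ)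
            (n := 1)).toContinuousLinearMap) ∘L
    ((ContinuousLinearMap.compL ℝ _ _ _
      (ContinuousAlternatingMap.alternatizeUncurryFinCLM ℝ V ℝ)) ∘L
      (ContinuousLinearMap.compL ℝ V _ _) ∘L (wedgeOneL V k).flip)

theorem wedgeTwoL_apply {k : ℕ} (ω : V [⋀^Fin 2]→L[ℝ] ℝ) (α : V [⋀^Fin k]→L[ℝ] ℝ)
    (v : Fin (k + 2) → V) :
    wedgeTwoL V k ω α v = (1 / 2) * ∑ i : Fin (k + 2), ∑ j : Fin (k + 1),
      (-1) ^ ((i : ℕ) + (j : ℕ)) *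
        (ω ![v i, i.removeNth v j] * α (j.removeNth (i.removeNth v))) := by
  simp [wedgeTwoL, ContinuousAlternatingMap.alternatizeUncurryFin_apply, wedgeOneL_apply, Finset.mul_sum, pow_add, mul_assoc]

theorem wedgeOneL_comp {W : Type*} [NormedAddCommGroup W] [NormedSpace ℝ W] {k : ℕ}
   (θ : V [⋀^Fin 1]→L[ℝ] ℝ) (α : V [⋀^Fin k]→L[ℝ] ℝ) (f : W →L[ℝ] V) :
   (wedgeOneL V k θ α).compContinuousLinearMap f =
     wedgeOneL W k (θ.compContinuousLinearMap f) (α.compContinuousLinearMap f) := by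
  ext v
  simp only [ContinuousAlternatingMap.compContinuousLinearMap_apply, wedgeOneL_apply]
  refine Finset.sum_congr rfl fun i _ => ?_
  congr 3
  ext j; simp

theorem wedgeTwoL_comp {W : Type*} [NormedAddCommGroup W] [NormedSpace ℝ W] {k : ℕ}
   (ω : V [⋀^Fin 2]→L[ℝ] ℝ) (α : V [⋀^Fin k]→L[ℝ] ℝ) (f : W →L[ℝ] V) :
   (wedgeTwoL V k ω α).compContinuousLinearMap f =
     wedgeTwoL W k (ω.compContinuousLinearMap f) (α.compContinuousLinearMap f) := by
  ext v
  simp only [ContinuousAlternatingMap.compContinuousLinearMap_apply, wedgeTwoL_apply]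
  congr 1
  refine Finset.sum_congr rfl fun i _ => Finset.sum_congr rfl fun j _ => ?_
  congr 3
  ext j; fin_cases j <;> simp [Fin.removeNth]

end Linear

section Forms

/-- `ℝᵐ` with its Euclidean norm, the model space. -/
abbrev Model (m : ℕ) : Type := EuclideanSpace ℝ (Fin m)

variable {m : ℕ} {M : Type*} [TopologicalSpace M] [ChartedSpace (Model m) M]

/-- Not necessarily smooth `k`-forms on `M`: a family of alternating forms on tangent spaces. -/
abbrev RoughForm (m : ℕ) (M : Type*) [TopologicalSpace M] [ChartedSpace (Model m) M] (k : ℕ) :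
    Type _ :=
  (x : M) → TangentSpace (𝓡 m) x [⋀^Fin k]→L[ℝ] ℝ

/-- The expression of a form in the chart `e`: the pullback of the form under `e.symm`. -/
def localRep {k : ℕ} (e : OpenPartialHomeomorph M (Model m)) (α : RoughForm m M k) (y : Model m) :
    Model m [⋀^Fin k]→L[ℝ] ℝ :=
  (α (e.symm y)).compContinuousLinearMap (mfderiv (𝓡 m) (𝓡 m) e.symm y)

/-- A form is smooth if its expression in every chart of the atlas is smooth. -/
def IsSmooth {k : ℕ} (α : RoughForm m M k) : Prop :=
  ∀ e ∈ atlas (Model m) M, ContDiffOn ℝ (⊤ : ℕ∞) (localRep e α) e.target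

theorem localRep_add {k : ℕ} (e : OpenPartialHomeomorph M (Model m)) (α β : RoughForm m M k) :
    localRep e (α + β) = localRep e α + localRep e β := by
  rfl

theorem localRep_smul {k : ℕ} (e : OpenPartialHomeomorph M (Model m)) (c : ℝ)
    (α : RoughForm m M k) : localRep e (c • α) = c • localRep e α := by
  rfl

theorem localRep_zero {k : ℕ} (e : OpenPartialHomeomorph M (Model m)) :
    localRep e (0 : RoughForm m M k) = 0 := by
  rfl

/-- The space `Ωᵏ(M)` of smooth `k`-forms. -/
def Form (m : ℕ) (M : Type*) [TopologicalSpace M] [ChartedSpace (Model m) M] (k : ℕ) :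
    Submodule ℝ (RoughForm m M k) where
  carrier := {α | IsSmooth α}
  add_mem' {α β} hα hβ e he := by
    rw [localRep_add]; exact (hα e he).add (hβ e he)
  zero_mem' e he := by
    rw [localRep_zero]; exact contDiffOn_const
  smul_mem' c α hα e he := by
    rw [localRep_smul]; exact (hα e he).const_smul c

/-- Pointwise exterior product of a `1`-form with a `k`-form. -/
def wedgeOneRough {k : ℕ} (θ : RoughForm m M 1) (α : RoughForm m M k) : RoughForm m M (k + 1) :=
  fun x => wedgeOneL (Model m) k (θ x) (α x)

/-- Pointwise exterior product of a `2`-form with a `k`-form. -/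
def wedgeTwoRough {k : ℕ} (ω : RoughForm m M 2) (α : RoughForm m M k) : RoughForm m M (k + 2) :=
  fun x => wedgeTwoL (Model m) k (ω x) (α x)

theorem IsSmooth.wedgeOne {k : ℕ} {θ : RoughForm m M 1} {α : RoughForm m M k}
    (hθ : IsSmooth θ) (hα : IsSmooth α) : IsSmooth (wedgeOneRough θ α) := fun e he =>
  (((wedgeOneL (Model m) k).contDiff.comp_contDiffOn (hθ e he)).clm_apply (hα e he)).congr
    fun y _ => wedgeOneL_comp (V := Model m) (W := Model m) (θ (e.symm y)) (α (e.symm y)) _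

theorem IsSmooth.wedgeTwo {k : ℕ} {ω : RoughForm m M 2} {α : RoughForm m M k}
    (hω : IsSmooth ω) (hα : IsSmooth α) : IsSmooth (wedgeTwoRough ω α) := fun e he =>
  (((wedgeTwoL (Model m) k).contDiff.comp_contDiffOn (hω e he)).clm_apply (hα e he)).congr
    fun y _ => wedgeTwoL_comp (V := Model m) (W := Model m) (ω (e.symm y)) (α (e.symm y)) _

/-- Exterior product with a smooth `1`-form, `α ↦ θ ∧ α`. -/
def wedgeOne (θ : Form m M 1) (k : ℕ) : Form m M k →ₗ[ℝ] Form m M (k + 1) where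
  toFun α := ⟨wedgeOneRough θ.1 α.1, IsSmooth.wedgeOne θ.2 α.2⟩
  map_add' α β := Subtype.ext <| funext fun x =>
    (wedgeOneL (Model m) k (θ.1 x)).map_add (α.1 x) (β.1 x)
  map_smul' c α := Subtype.ext <| funext fun x =>
    (wedgeOneL (Model m) k (θ.1 x)).map_smul c (α.1 x)

/-- Exterior product with a smooth `2`-form, `α ↦ ω ∧ α`. -/
def wedgeTwo (ω : Form m M 2) (k : ℕ) : Form m M k →ₗ[ℝ] Form m M (k + 2) where
  toFun α := ⟨wedgeTwoRough ω.1 α.1, IsSmooth.wedgeTwo ω.2 α.2⟩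
  map_add' α β := Subtype.ext <| funext fun x =>
    (wedgeTwoL (Model m) k (ω.1 x)).map_add (α.1 x) (β.1 x)
  map_smul' c α := Subtype.ext <| funext fun x =>
    (wedgeTwoL (Model m) k (ω.1 x)).map_smul c (α.1 x)

/-- The exterior derivative: at `x` it is computed in the preferred chart at `x` and pulled back to
the tangent space at `x`. By `localRep_extDRough` any other chart gives the same result. -/
def extDRough {k : ℕ} (α : RoughForm m M k) : RoughForm m M (k + 1) := fun x =>
  (extDeriv (localRep (chartAt (Model m) x) α) (chartAt (Model m) x x)).compContinuousLinearMap
    (mfderiv (𝓡 m) (𝓡 m) (chartAt (Model m) x) x : TangentSpace (𝓡 m) x →L[ℝ] Model m)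

theorem differentiableAt_localRep {k : ℕ} {α : RoughForm m M k} (hα : IsSmooth α) (x : M) :
    DifferentiableAt ℝ (localRep (chartAt (Model m) x) α) (chartAt (Model m) x x) :=
  ((hα _ (chart_mem_atlas _ x)).contDiffAt ((chartAt (Model m) x).open_target.mem_nhds
    (mem_chart_target _ x))).differentiableAt (by simp)

section Smooth
variable [IsManifold (𝓡 m) (⊤ : ℕ∞) M]

theorem contDiffAt_transition {e e' : OpenPartialHomeomorph M (Model m)}
    (he : e ∈ atlas (Model m) M) (he' : e' ∈ atlas (Model m) M) {y : Model m}
    (hy : y ∈ e.target) (hy' : e.symm y ∈ e'.source) :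
    ContDiffAt ℝ (⊤ : ℕ∞) (e' ∘ e.symm) y := by
  have h1 : ContMDiffAt (𝓡 m) (𝓡 m) (⊤ : ℕ∞) e.symm y :=
    (contMDiffOn_symm_of_mem_maximalAtlas
      (IsManifold.subset_maximalAtlas he)).contMDiffAt (e.open_target.mem_nhds hy)
  have h2 : ContMDiffAt (𝓡 m) (𝓡 m) (⊤ : ℕ∞) e' (e.symm y) :=
    (contMDiffOn_of_mem_maximalAtlas
      (IsManifold.subset_maximalAtlas he')).contMDiffAt (e'.open_source.mem_nhds hy')
  exact (h2.comp y h1).contDiffAt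

theorem mfderiv_symm_eq {e e' : OpenPartialHomeomorph M (Model m)}
    (he : e ∈ atlas (Model m) M) (he' : e' ∈ atlas (Model m) M) {y : Model m}
    (hy : y ∈ e.target) (hy' : e.symm y ∈ e'.source) (v : Model m) :
    (mfderiv (𝓡 m) (𝓡 m) e.symm y v : Model m) =
      mfderiv (𝓡 m) (𝓡 m) e'.symm (e' (e.symm y)) (fderiv ℝ (e' ∘ e.symm) y v) := by
  have hev : e.symm =ᶠ[𝓝 y] e'.symm ∘ (e' ∘ e.symm) := by
    have hc : ContinuousAt e.symm y := e.symm.continuousAt hy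
    filter_upwards [hc.preimage_mem_nhds (e'.open_source.mem_nhds hy')] with z hz
    exact (e'.left_inv hz).symm
  have hτ : MDifferentiableAt (𝓡 m) (𝓡 m) (e' ∘ e.symm) y :=
    ((contDiffAt_transition he he' hy hy').differentiableAt (by simp)).mdifferentiableAt
  have hs : MDifferentiableAt (𝓡 m) (𝓡 m) e'.symm ((e' ∘ e.symm) y) := by
    have : IsManifold (𝓡 m) 1 M := IsManifold.of_le (n := (⊤ : ℕ∞)) (by exact_mod_cast le_top)
    exact mdifferentiableAt_atlas_symm he' (e'.map_source hy')
  rw [hev.mfderiv_eq, mfderiv_comp y hs hτ, mfderiv_eq_fderiv]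
  rfl

theorem localRep_change {k : ℕ} (α : RoughForm m M k) {e e' : OpenPartialHomeomorph M (Model m)}
    (he : e ∈ atlas (Model m) M) (he' : e' ∈ atlas (Model m) M) {y : Model m}
    (hy : y ∈ e.target) (hy' : e.symm y ∈ e'.source) :
    localRep e α y = (localRep e' α ((e' ∘ e.symm) y)).compContinuousLinearMap
      (fderiv ℝ (e' ∘ e.symm) y) := by
  ext v
  simp only [localRep, ContinuousAlternatingMap.compContinuousLinearMap_apply, Function.comp_def]
  have hx : e'.symm (e' (e.symm y)) = e.symm y := e'.left_inv hy'
  have key : ∀ (x x' : M) (_ : x = x') (u w : Fin k → Model m) (_ : u = w),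
      (α x : Model m [⋀^Fin k]→L[ℝ] ℝ) u = (α x' : Model m [⋀^Fin k]→L[ℝ] ℝ) w := by
    rintro x _ rfl u _ rfl; rfl
  exact key _ _ hx.symm _ _ (funext fun i => mfderiv_symm_eq he he' hy hy' (v i))

theorem localRep_extDRough {k : ℕ} {α : RoughForm m M k} (hα : IsSmooth α)
    {e : OpenPartialHomeomorph M (Model m)} (he : e ∈ atlas (Model m) M) {y : Model m}
    (hy : y ∈ e.target) : localRep e (extDRough α) y = extDeriv (localRep e α) y := by
  set e' := chartAt (Model m) (e.symm y) with he'def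
  have he' : e' ∈ atlas (Model m) M := chart_mem_atlas _ _
  have hy' : e.symm y ∈ e'.source := mem_chart_source _ _
  have hsm := contDiffAt_transition he he' hy hy'
  have hev : localRep e α =ᶠ[𝓝 y] fun z => (localRep e' α ((e' ∘ e.symm) z)).compContinuousLinearMap
      (fderiv ℝ (e' ∘ e.symm) z) := by
    filter_upwards [(e.symm.continuousAt hy).preimage_mem_nhds (e'.open_source.mem_nhds hy'),
      e.open_target.mem_nhds hy] with z hz hz'
    exact localRep_change α he he' hz' hz
  have hd : DifferentiableAt ℝ (localRep e' α) ((e' ∘ e.symm) y) :=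
    ((hα e' he').contDiffAt (e'.open_target.mem_nhds (e'.map_source hy'))).differentiableAt
      (by simp)
  rw [hev.extDeriv_eq, extDeriv_pullback hd hsm (by simp; exact WithTop.coe_le_coe.2 le_top)]
  have : IsManifold (𝓡 m) 1 M := IsManifold.of_le (n := (⊤ : ℕ∞)) (by exact_mod_cast le_top)
  have h1 : MDifferentiableAt (𝓡 m) (𝓡 m) e.symm y := mdifferentiableAt_atlas_symm he hy
  have h2 : MDifferentiableAt (𝓡 m) (𝓡 m) e' (e.symm y) := mdifferentiableAt_atlas he' hy'
  have hc := mfderiv_comp y h2 h1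
  rw [mfderiv_eq_fderiv] at hc
  rw [hc]
  rfl

theorem IsSmooth.extD {k : ℕ} {α : RoughForm m M k} (hα : IsSmooth α) :
    IsSmooth (extDRough α) := fun e he => by
  have h : ContDiffOn ℝ (⊤ : ℕ∞) (extDeriv (localRep e α)) e.target := by
    have h1 : ContDiffOn ℝ (⊤ : ℕ∞) (fderiv ℝ (localRep e α)) e.target :=
      (hα e he).fderiv_of_isOpen e.open_target (by simp)
    exact (ContinuousAlternatingMap.alternatizeUncurryFinCLM ℝ (Model m) ℝ).contDiff.comp_contDiffOn
      h1
  exact h.congr fun y hy => localRep_extDRough hα he hy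

/-- The exterior derivative `d : Ωᵏ(M) → Ωᵏ⁺¹(M)`. -/
def extD (k : ℕ) : Form m M k →ₗ[ℝ] Form m M (k + 1) where
  toFun α := ⟨extDRough α.1, IsSmooth.extD α.2⟩
  map_add' α β := Subtype.ext <| funext fun x => by
    change extDRough (α.1 + β.1) x = extDRough α.1 x + extDRough β.1 x
    simp only [extDRough]
    rw [localRep_add, extDeriv_add (differentiableAt_localRep α.2 x)
      (differentiableAt_localRep β.2 x)]
    rfl
  map_smul' c α := Subtype.ext <| funext fun x => by
    change extDRough (c • α.1) x = c • extDRough α.1 x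
    simp only [extDRough]
    rw [localRep_smul, extDeriv_smul]
    rfl

end Smooth
end Forms

section Operators

variable {m : ℕ} {M : Type*} [TopologicalSpace M] [ChartedSpace (Model m) M]

/-- The space `Ω*(M)` of all differential forms. Since `Ωᵏ(M) = 0` for `k > m`, the product over
all degrees is the direct sum. -/
def Forms (m : ℕ) (M : Type*) [TopologicalSpace M] [ChartedSpace (Model m) M] : Type _ :=
  (k : ℕ) → Form m M k

instance : AddCommGroup (Forms m M) := inferInstanceAs (AddCommGroup ((k : ℕ) → Form m M k))

instance : Module ℝ (Forms m M) := inferInstanceAs (Module ℝ ((k : ℕ) → Form m M k))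

/-- The element of `Ω*(M)` with given components. -/
def Forms.mk (f : (k : ℕ) → Form m M k) : Forms m M := f

/-- The component of degree `k`. -/
def Forms.comp (k : ℕ) : Forms m M →ₗ[ℝ] Form m M k where
  toFun α := α k
  map_add' _ _ := rfl
  map_smul' _ _ := rfl

@[simp] theorem Forms.comp_mk (f : (k : ℕ) → Form m M k) (k : ℕ) : Forms.comp k (Forms.mk f) = f k :=
  rfl

theorem Forms.ext {α β : Forms m M} (h : ∀ k, Forms.comp k α = Forms.comp k β) : α = β := funext h

/-- `Ωᵏ(M)` as a subspace of `Ω*(M)`, for `k ∈ ℤ`; it is zero for `k < 0`. -/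
def homog (m : ℕ) (M : Type*) [TopologicalSpace M] [ChartedSpace (Model m) M] (k : ℤ) :
    Submodule ℝ (Forms m M) where
  carrier := {α | ∀ j : ℕ, (j : ℤ) ≠ k → Forms.comp j α = 0}
  add_mem' {α β} hα hβ j hj := by rw [map_add, hα j hj, hβ j hj, add_zero]
  zero_mem' j _ := map_zero (Forms.comp j)
  smul_mem' c α hα j hj := by rw [map_smul, hα j hj, smul_zero]

/-- The Lefschetz operator `L α = ω ∧ α`. -/
def lef (ω : Form m M 2) : Forms m M →ₗ[ℝ] Forms m M where
  toFun α := Forms.mk fun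
    | 0 => 0
    | 1 => 0
    | k + 2 => wedgeTwo ω k (Forms.comp k α)
  map_add' α β := Forms.ext fun k => match k with
    | 0 => by simp
    | 1 => by simp
    | k + 2 => by simp
  map_smul' c α := Forms.ext fun k => match k with
    | 0 => by simp
    | 1 => by simp
    | k + 2 => by simp

/-- The twisted (Lichnerowicz) differential `d_l α = dα + l θ ∧ α`. -/
def lich [IsManifold (𝓡 m) (⊤ : ℕ∞) M] (θ : Form m M 1) (l : ℤ) :
    Forms m M →ₗ[ℝ] Forms m M where
  toFun α := Forms.mk fun
    | 0 => 0
    | k + 1 => extD k (Forms.comp k α) + (l : ℝ) • wedgeOne θ k (Forms.comp k α)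
  map_add' α β := Forms.ext fun k => match k with
    | 0 => by simp
    | k + 1 => by
      simp only [Forms.comp_mk, map_add, smul_add]
      abel
  map_smul' c α := Forms.ext fun k => match k with
    | 0 => by simp
    | k + 1 => by
      simp only [Forms.comp_mk, map_smul, RingHom.id_apply, smul_add]
      rw [smul_comm c (l : ℝ)]

/-- A locally conformal symplectic structure: a non-degenerate `2`-form `ω` and a closed `1`-form
`θ` with `dω = - ω ∧ θ = - θ ∧ ω`. -/
structure IsLCS [IsManifold (𝓡 m) (⊤ : ℕ∞) M] (ω : Form m M 2) (θ : Form m M 1) : Prop where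
  nondegenerate : ∀ (x : M) (v : TangentSpace (𝓡 m) x),
    (∀ w : TangentSpace (𝓡 m) x, ω.1 x ![v, w] = 0) → v = 0
  closed : extD 1 θ = 0
  d_form : extD 2 ω = - wedgeOne θ 2 ω

end Operators

section Subquotients

/-- The subquotient `A / B` of a vector space, for subspaces `B ≤ A`. -/
abbrev SubQuot {V : Type*} [AddCommGroup V] [Module ℝ V] (A B : Submodule ℝ V) : Type _ :=
  A ⧸ B.submoduleOf A

/-- The class in `A / B` of an element of `A`. -/
def SubQuot.cls {V : Type*} [AddCommGroup V] [Module ℝ V] {A B : Submodule ℝ V} (x : V)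
    (hx : x ∈ A) : SubQuot A B :=
  (B.submoduleOf A).mkQ ⟨x, hx⟩

/-- `φ : A / B → A' / B'` is the (well defined) map `[f x] ↦ [g x]`, where `x` runs through `S`:
every class in `A / B` is of the form `[f x]` with `x ∈ S`, and `φ [f x] = [g x]` for every such
`x`. In particular there is at most one such `φ`. -/
structure IsGivenBy {V : Type*} [AddCommGroup V] [Module ℝ V] {A B A' B' : Submodule ℝ V}
    (φ : SubQuot A B →ₗ[ℝ] SubQuot A' B') (S : Submodule ℝ V) (f g : V →ₗ[ℝ] V) : Prop where
  exists_rep : ∀ c : SubQuot A B, ∃ x ∈ S, ∃ h : f x ∈ A, c = SubQuot.cls (f x) h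
  map_rep : ∀ x ∈ S, ∃ (h : f x ∈ A) (h' : g x ∈ A'),
    φ (SubQuot.cls (f x) h) = SubQuot.cls (g x) h'

/-- `φ : A / B → A' / B'` is induced by the linear map `g`, i.e. `φ [x] = [g x]` for `x ∈ A`. -/
def IsInducedBy {V : Type*} [AddCommGroup V] [Module ℝ V] {A B A' B' : Submodule ℝ V}
    (φ : SubQuot A B →ₗ[ℝ] SubQuot A' B') (g : V →ₗ[ℝ] V) : Prop :=
  IsGivenBy φ A LinearMap.id g

end Subquotients

section Cohomology

variable {m n : ℕ} {M : Type*} [TopologicalSpace M]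

/-- The Lichnerowicz–Novikov cohomology `H^k_l(M) = H^k(Ω*(M), d_l)`. -/
abbrev Coh [ChartedSpace (Model m) M] [IsManifold (𝓡 m) (⊤ : ℕ∞) M] (θ : Form m M 1) (l k : ℤ) :
    Type _ :=
  SubQuot (LinearMap.ker (lich θ l) ⊓ homog m M k) ((homog m M (k - 1)).map (lich θ l))

/-- The Lefschetz filtration `F^p = L^p Ω*(M)` (with `F^p = Ω*(M)` for `p ≤ 0`). -/
def filt [ChartedSpace (Model m) M] (ω : Form m M 2) (p : ℤ) : Submodule ℝ (Forms m M) :=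
  LinearMap.range (lef ω ^ p.toNat)

/-- `Z_r^{p,q} = F^p Ω^{p+q} ∩ d_k⁻¹ (F^{p+r} Ω^{p+q+1})`. -/
def cyc [ChartedSpace (Model m) M] [IsManifold (𝓡 m) (⊤ : ℕ∞) M] (ω : Form m M 2)
    (θ : Form m M 1) (k r p q : ℤ) : Submodule ℝ (Forms m M) :=
  (filt ω p ⊓ homog m M (p + q)) ⊓ (filt ω (p + r)).comap (lich θ k)

/-- The term `E^{p,q}_{k,r}`, `r ≥ 1`, of the spectral sequence of the filtered complex
`(Ω*(M), F, d_k)`: `E_r^{p,q} = Z_r^{p,q} / (Z_{r-1}^{p+1,q-1} + d_k Z_{r-1}^{p-r+1,q+r-2})`. -/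
abbrev Page [ChartedSpace (Model m) M] [IsManifold (𝓡 m) (⊤ : ℕ∞) M] (ω : Form m M 2)
    (θ : Form m M 1) (k r p q : ℤ) : Type _ :=
  SubQuot (cyc ω θ k r p q)
    (cyc ω θ k (r - 1) (p + 1) (q - 1) ⊔
      (cyc ω θ k (r - 1) (p - r + 1) (q + r - 2)).map (lich θ k))

variable [ChartedSpace (Model (2 * n)) M]

/-- The space `𝒫^k` of primitive `k`-forms on a `2n`-dimensional manifold: forms with
`L^{n-k+1} α = 0` if `k ≤ n`, and zero if `k > n`. -/
def prim (ω : Form (2 * n) M 2) (k : ℤ) : Submodule ℝ (Forms (2 * n) M) :=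
  if k ≤ n then homog (2 * n) M k ⊓ LinearMap.ker (lef ω ^ ((n : ℤ) - k + 1).toNat) else ⊥

/-- The space `𝒫* = ⨁ 𝒫^k` of primitive forms. -/
def primTotal (ω : Form (2 * n) M 2) : Submodule ℝ (Forms (2 * n) M) := ⨆ k : ℤ, prim ω k

open Classical in
/-- The projection `Π_pr` of `Ω* = 𝒫* ⊕ L Ω*` onto `𝒫*`. For non-degenerate `ω` this decomposition
is the Lefschetz decomposition; the value `0` is a default for other `ω`. -/
def primProj (ω : Form (2 * n) M 2) : Forms (2 * n) M →ₗ[ℝ] Forms (2 * n) M :=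
  if h : IsCompl (primTotal ω) (LinearMap.range (lef ω)) then (primTotal ω).projection _ h else 0

/-- The forms of degree at most `n - 1`; for non-degenerate `ω` the operator `L` is injective
on them. -/
def lowForms (n : ℕ) (M : Type*) [TopologicalSpace M] [ChartedSpace (Model (2 * n)) M] :
    Submodule ℝ (Forms (2 * n) M) where
  carrier := {α | ∀ j : ℕ, n ≤ j → Forms.comp j α = 0}
  add_mem' {α β} hα hβ j hj := by rw [map_add, hα j hj, hβ j hj, add_zero]
  zero_mem' j _ := map_zero (Forms.comp j)
  smul_mem' c α hα j hj := by rw [map_smul, hα j hj, smul_zero]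

open Classical in
/-- A left inverse of `L` on the forms of degree at most `n - 1` (with default `0` if `L` is not
injective there). -/
def lefInv (ω : Form (2 * n) M 2) : Forms (2 * n) M →ₗ[ℝ] Forms (2 * n) M :=
  if h : ∃ T : Forms (2 * n) M →ₗ[ℝ] Forms (2 * n) M, ∀ α ∈ lowForms n M, T (lef ω α) = α
  then h.choose else 0

variable [IsManifold (𝓡 (2 * n)) (⊤ : ℕ∞) M]

/-- `d_l⁺ = Π_pr d_l`. -/
def dPlus (ω : Form (2 * n) M 2) (θ : Form (2 * n) M 1) (l : ℤ) :
    Forms (2 * n) M →ₗ[ℝ] Forms (2 * n) M :=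
  primProj ω ∘ₗ lich θ l

/-- The operator `d_l⁻` determined on forms of degree at most `n` by `d_l = d_l⁺ + L d_l⁻`. It is
used only in these degrees, where `d_l⁻ α` is the only form of degree one less than `α` with
`d_l α = d_l⁺ α + L d_l⁻ α`. -/
def dMinus (ω : Form (2 * n) M 2) (θ : Form (2 * n) M 1) (l : ℤ) :
    Forms (2 * n) M →ₗ[ℝ] Forms (2 * n) M :=
  lefInv ω ∘ₗ (lich θ l - dPlus ω θ l)

/-- `C^k_l = (ker d_l⁻ ∩ Ω^k) / d_l Ω^{k-1}`, for `0 ≤ k ≤ n`. -/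
abbrev CGroup (ω : Form (2 * n) M 2) (θ : Form (2 * n) M 1) (l k : ℤ) : Type _ :=
  SubQuot (LinearMap.ker (dMinus ω θ l) ⊓ homog (2 * n) M k)
    ((homog (2 * n) M (k - 1)).map (lich θ l))

end Cohomology

end LCS

end

noncomputable section

namespace LCS

/-! Everything rests on two facts. First, `d_l L = L d_{l-1}` and `d_l ^ 2 = 0` (`lich_lef`,
`lich_lich`). Second, the hard Lefschetz property: `L^r` is injective on degree `k` when `k + r ≤
n`, and bijective from degree `n - r` to degree `n + r` (`eq_zero_of_lef_pow_eq_zero`,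
`exists_lef_pow_eq`). The second fact gives the splitting of a form into a primitive part plus `L
γ`, and hence `d_l⁺` and `d_l⁻`.

With `k = q - p`, an `E₁` boundary is exactly `L^p (L γ + d_l η)` (`mem_pageBoundary_one`). As long
as `q ≤ n`, the factor `L^p` can be cancelled in degree `k`. So `E₁` behaves like the cohomology of
`Ω / L Ω`, and the long sequence is the one attached to `0 → Ω → Ω → Ω / L Ω → 0` with `L` as the
first map. Here `d_l⁻` is the connecting map: a primitive `x` with `d_l⁺ x = 0` satisfies `d_l x = L
(d_l⁻ x)`. The diagram chase needs `L` to be injective, which holds only in degrees below `n`.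

At `q = n` the cocycle condition on `L^p x` is automatic, because `L^p` kills primitive forms of
degree `n - p + 1`. Closed forms must then be replaced by forms with `d_l⁻ α = 0`. The criterion
`dMinus_eq_zero_iff` rewrites this as `L^r (d_l α) = 0` with `r = n - k`, so that `L^(p+1)` matches
the kernel of `d_{l-1}⁻` in degree `n - p - 1` with the closed forms of degree `n + p + 1`. This
gives the last terms of the sequence and the final surjectivity.

On subquotients, `exists_isGivenBy` and `IsGivenBy.exact` reduce the existence of maps and exactness
to statements about representing forms. -/

theorem eq_zero_of_eq_neg {W : Type*} [AddCommGroup W] [Module ℝ W] {x : W} (h : x = -x) :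
    x = 0 := by
  have : (2 : ℝ) • x = 0 := by
    rw [two_smul]; nth_rewrite 1 [h]; exact neg_add_cancel x
  exact (smul_eq_zero.1 this).resolve_left two_ne_zero

/-! ### Alternating sums over deleted arguments. -/

section AltSum

variable {V : Type*} {k : ℕ}

/-- The alternating sum `∑ (-1)ⁱ f (vᵢ) (v₀, …, v̂ᵢ, …, vₖ)` underlying all exterior operations. -/
def altSum (f : V → (Fin k → V) → ℝ) (v : Fin (k + 1) → V) : ℝ :=
  ∑ i : Fin (k + 1), (-1) ^ (i : ℕ) * f (v i) (i.removeNth v)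

theorem altSum_add (f g : V → (Fin k → V) → ℝ) :
    altSum (fun x => f x + g x) = altSum f + altSum g := by
  ext v; simp [altSum, mul_add, Finset.sum_add_distrib]

theorem altSum_smul (c : ℝ) (f : V → (Fin k → V) → ℝ) :
    altSum (fun x => c • f x) = c • altSum f := by
  ext v; simp [altSum, Finset.mul_sum, mul_left_comm]

theorem altSum_neg (f : V → (Fin k → V) → ℝ) :
    altSum (fun x => -f x) = -altSum f := by
  ext v; simp [altSum]

theorem altSum_sub (f g : V → (Fin k → V) → ℝ) :
    altSum (fun x => f x - g x) = altSum f - altSum g := by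
  ext v; simp [altSum, mul_sub]

/-- Deleting two arguments in either order leaves the same tuple, but with opposite signs. Grouping
the double sum by unordered pairs therefore shows only the antisymmetric part of `f` in its first
two variables. -/
theorem altSum_altSum_apply (f : V → V → (Fin k → V) → ℝ) (v : Fin (k + 2) → V) :
    altSum (fun x => altSum (f x)) v = ∑ i : Fin (k + 1), ∑ j ≥ i, (-1) ^ (i + j : ℕ) *
      (f (v i.castSucc) (v j.succ) (j.removeNth <| i.castSucc.removeNth v) -
        f (v j.succ) (v i.castSucc) (j.removeNth <| i.castSucc.removeNth v)) := by
  simp only [altSum, Finset.mul_sum, Fin.sum_sum_eq_sum_triangle_add, Fin.val_castSucc,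
    Fin.val_succ]
  refine Fintype.sum_congr _ _ fun i => Finset.sum_congr rfl fun j hj => ?_
  rw [Finset.mem_Ici] at hj
  have H₁ : i.castSucc.removeNth v j = v j.succ := by
    simp [Fin.removeNth_apply, Fin.succAbove_of_le_castSucc, hj]
  have H₂ : j.succ.removeNth v i = v i.castSucc := by
    simp [Fin.removeNth_apply, Fin.succAbove_of_castSucc_lt, hj]
  have H₃ : i.removeNth (j.succ.removeNth v) = j.removeNth (i.castSucc.removeNth v) := by
    rw [Fin.removeNth_removeNth_eq_swap]
    simp [Fin.predAbove, hj, Fin.succAbove]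
  rw [H₁, H₂, H₃]
  ring

theorem altSum_swap (f : V → V → (Fin k → V) → ℝ) :
    altSum (fun x => altSum fun y => f x y) = -altSum (fun x => altSum fun y => f y x) := by
  ext v
  rw [Pi.neg_apply, altSum_altSum_apply f, altSum_altSum_apply fun x y => f y x]
  simp only [← Finset.sum_neg_distrib]
  exact Finset.sum_congr rfl fun i _ => Finset.sum_congr rfl fun j _ => by ring

theorem altSum_cons (f : V → (Fin (k + 1) → V) → ℝ) (x : V) (v : Fin (k + 1) → V) :
    altSum f (Fin.cons x v) = f x v - altSum (fun y u => f y (Fin.cons x u)) v := by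
  have h : ∀ i : Fin (k + 1), i.succ.removeNth (Fin.cons x v : Fin (k + 2) → V) =
      Fin.cons x (i.removeNth v) := fun i => by
    ext j
    refine Fin.cases ?_ (fun j => ?_) j <;> simp [Fin.removeNth_apply]
  rw [altSum, Fin.sum_univ_succ, altSum, sub_eq_add_neg, ← Finset.sum_neg_distrib]
  congr 1
  · simp
  · refine Finset.sum_congr rfl fun i _ => ?_
    rw [h i]
    simp [pow_succ]

theorem altSum_pair (f : V → (Fin 1 → V) → ℝ) (x y : V) :
    altSum f ![x, y] = f x ![y] - f y ![x] := by
  have h0 : (0 : Fin 2).removeNth ![x, y] = ![y] := by ext i; fin_cases i; rfl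
  have h1 : (1 : Fin 2).removeNth ![x, y] = ![x] := by ext i; fin_cases i; rfl
  refine (Fin.sum_univ_two _).trans ?_
  rw [h0, h1]
  simp [sub_eq_add_neg]

theorem altSum_triple (f : V → (Fin 2 → V) → ℝ) (x y z : V) :
    altSum f ![x, y, z] = f x ![y, z] - f y ![x, z] + f z ![x, y] := by
  have h0 : (0 : Fin 3).removeNth ![x, y, z] = ![y, z] := by ext i; fin_cases i <;> rfl
  have h1 : (1 : Fin 3).removeNth ![x, y, z] = ![x, z] := by ext i; fin_cases i <;> rfl
  have h2 : (2 : Fin 3).removeNth ![x, y, z] = ![x, y] := by ext i; fin_cases i <;> rfl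
  refine (Fin.sum_univ_three _).trans ?_
  rw [h0, h1, h2]
  simp [sub_eq_add_neg]

end AltSum

/-! ### Exterior products as alternating sums. -/

section Wedge

variable {V : Type*} [NormedAddCommGroup V] [NormedSpace ℝ V] {k : ℕ}

theorem coe_wedgeOneL (θ : V [⋀^Fin 1]→L[ℝ] ℝ) (α : V [⋀^Fin k]→L[ℝ] ℝ) :
    ⇑(wedgeOneL V k θ α) = altSum fun x => θ ![x] • ⇑α := by
  ext v; simp [wedgeOneL_apply, altSum]

theorem coe_wedgeTwoL (ω : V [⋀^Fin 2]→L[ℝ] ℝ) (α : V [⋀^Fin k]→L[ℝ] ℝ) :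
    ⇑(wedgeTwoL V k ω α) = (1 / 2 : ℝ) • altSum fun x => altSum fun y => ω ![x, y] • ⇑α := by
  ext v; simp [wedgeTwoL_apply, altSum, Finset.mul_sum, pow_add, mul_assoc]

theorem coe_alternatizeUncurryFin (f : V →L[ℝ] V [⋀^Fin k]→L[ℝ] ℝ) :
    ⇑(ContinuousAlternatingMap.alternatizeUncurryFin f) = altSum fun x => ⇑(f x) := by
  ext v; simp [ContinuousAlternatingMap.alternatizeUncurryFin_apply, altSum]

theorem twoForm_swap (ω : V [⋀^Fin 2]→L[ℝ] ℝ) (x y : V) : ω ![x, y] = -ω ![y, x] := by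
  refine Eq.trans (congrArg ω ?_) (ω.map_swap ![y, x] (i := 0) (j := 1) (by decide))
  ext i; fin_cases i <;> simp

/-- The contraction of a `2`-form with a vector. -/
def contractTwo (ω : V [⋀^Fin 2]→L[ℝ] ℝ) (x : V) : V [⋀^Fin 1]→L[ℝ] ℝ := ω.curryLeft x

theorem contractTwo_apply (ω : V [⋀^Fin 2]→L[ℝ] ℝ) (x y : V) :
    contractTwo ω x ![y] = ω ![x, y] := rfl

theorem altSum_wedgeOneL (θ : V [⋀^Fin 1]→L[ℝ] ℝ) (f : V → V [⋀^Fin k]→L[ℝ] ℝ) :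
    (altSum fun x => ⇑(wedgeOneL V k θ (f x))) =
      -altSum fun x => θ ![x] • altSum fun y => ⇑(f y) := by
  simp only [coe_wedgeOneL]
  rw [altSum_swap]
  simp only [altSum_smul]

/-- Moving the outer sum past the two sums hidden in `ω ∧ ·` costs two signs, which cancel. With `f
x = θ(x) α` this gives commutation of `θ ∧ ·` and `ω ∧ ·`; with `f` a derivative it gives half of
the Leibniz rule. -/
theorem altSum_wedgeTwoL (ω : V [⋀^Fin 2]→L[ℝ] ℝ) (f : V → V [⋀^Fin k]→L[ℝ] ℝ) :
    (altSum fun x => ⇑(wedgeTwoL V k ω (f x))) =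
      (1 / 2 : ℝ) • altSum fun x => altSum fun y => ω ![x, y] • altSum fun z => ⇑(f z) := by
  simp only [coe_wedgeTwoL, altSum_smul]
  rw [altSum_swap]
  conv_lhs =>
    enter [2, 1, 1, x]
    rw [altSum_swap]
  simp only [altSum_smul, altSum_neg, neg_neg]

theorem wedgeOneL_wedgeOneL (θ η : V [⋀^Fin 1]→L[ℝ] ℝ) (α : V [⋀^Fin k]→L[ℝ] ℝ) :
    wedgeOneL V _ θ (wedgeOneL V _ η α) = -wedgeOneL V _ η (wedgeOneL V _ θ α) := by
  apply DFunLike.coe_injective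
  rw [ContinuousAlternatingMap.coe_neg, coe_wedgeOneL, coe_wedgeOneL η, coe_wedgeOneL η,
    coe_wedgeOneL θ]
  simp only [← altSum_smul]
  rw [altSum_swap]
  simp only [smul_comm (η _) (θ _)]

theorem wedgeOneL_self (θ : V [⋀^Fin 1]→L[ℝ] ℝ) (α : V [⋀^Fin k]→L[ℝ] ℝ) :
    wedgeOneL V _ θ (wedgeOneL V _ θ α) = 0 :=
  eq_zero_of_eq_neg (wedgeOneL_wedgeOneL θ θ α)

theorem wedgeOneL_wedgeTwoL (θ : V [⋀^Fin 1]→L[ℝ] ℝ) (ω : V [⋀^Fin 2]→L[ℝ] ℝ)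
    (α : V [⋀^Fin k]→L[ℝ] ℝ) :
    wedgeOneL V _ θ (wedgeTwoL V _ ω α) = wedgeTwoL V _ ω (wedgeOneL V _ θ α) := by
  apply DFunLike.coe_injective
  have h := altSum_wedgeTwoL ω fun x => θ ![x] • α
  simp only [map_smul, ContinuousAlternatingMap.coe_smul] at h
  rw [coe_wedgeOneL, h, coe_wedgeTwoL, coe_wedgeOneL]

/-- If the antisymmetrization of `T` vanishes then so does that of `T ∧ α`. -/
theorem altSum_wedgeOneL_eq_zero (T : V → V [⋀^Fin 1]→L[ℝ] ℝ)
    (hT : (altSum fun x => ⇑(T x)) = 0) (α : V [⋀^Fin k]→L[ℝ] ℝ) :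
    (altSum fun x => ⇑(wedgeOneL V k (T x) α)) = 0 := by
  have hs : ∀ x y, T x ![y] = T y ![x] := fun x y => by
    have := congrFun hT ![x, y]
    rw [altSum_pair, Pi.zero_apply] at this
    linarith
  simp only [coe_wedgeOneL]
  have h := altSum_swap fun x y => T x ![y] • ⇑α
  have h' : (fun x => altSum fun y => T y ![x] • ⇑α) = fun x => altSum fun y => T x ![y] • ⇑α := by
    ext x : 1
    simp only [hs x]
  rw [h'] at h
  exact eq_zero_of_eq_neg h

/-- The hypothesis is the cyclic identity `T x (y, z) - T y (x, z) + T z (x, y) = 0`. After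
antisymmetrizing against `α`, permuting the variables turns each of the three terms into the same
quantity `X`, so `3 X = 0`. -/
theorem altSum_wedgeTwoL_eq_zero (T : V → V [⋀^Fin 2]→L[ℝ] ℝ)
    (hT : (altSum fun x => ⇑(T x)) = 0) (α : V [⋀^Fin k]→L[ℝ] ℝ) :
    (altSum fun x => ⇑(wedgeTwoL V k (T x) α)) = 0 := by
  have hs : ∀ x y z, T x ![y, z] - T y ![x, z] = - T z ![x, y] := fun x y z => by
    have := congrFun hT ![x, y, z]
    rw [altSum_triple, Pi.zero_apply] at this
    linarith
  simp only [coe_wedgeTwoL, altSum_smul]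
  set X := altSum fun x => altSum fun y => altSum fun z => T x ![y, z] • ⇑α with hX
  have e1 : X - (altSum fun x => altSum fun y => altSum fun z => T y ![x, z] • ⇑α) =
      altSum fun x => altSum fun y => altSum fun z => - (T z ![x, y] • ⇑α) := by
    rw [hX, ← altSum_sub]
    simp only [← altSum_sub, ← sub_smul, hs, neg_smul]
  have e2 : (altSum fun x => altSum fun y => altSum fun z => T y ![x, z] • ⇑α) = -X :=
    altSum_swap _
  have e3 : (altSum fun x => altSum fun y => altSum fun z => - (T z ![x, y] • ⇑α)) = -X := by
    rw [← e2]
    congr 1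
    ext x : 1
    rw [altSum_swap]
    simp only [altSum_neg, neg_neg]
  rw [e2, e3] at e1
  have : (3 : ℝ) • X = 0 := by
    ext v
    have := congrFun e1 v
    simp only [Pi.sub_apply, Pi.neg_apply] at this
    simp only [Pi.smul_apply, Pi.zero_apply, smul_eq_mul]
    linarith
  have hX0 : X = 0 := (smul_eq_zero.1 this).resolve_left (by norm_num)
  rw [hX0, smul_zero]

end Wedge

/-! ### Pointwise hard Lefschetz by contraction. -/

section Graded

variable {V : Type*} [NormedAddCommGroup V] [NormedSpace ℝ V]

theorem curryLeft_wedgeOneL_zero (θ : V [⋀^Fin 1]→L[ℝ] ℝ) (α : V [⋀^Fin 0]→L[ℝ] ℝ) (x : V) :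
    (wedgeOneL V 0 θ α).curryLeft x = θ ![x] • α := by
  ext v
  change wedgeOneL V 0 θ α (Fin.cons x v) = _
  rw [coe_wedgeOneL, altSum, Fin.sum_univ_succ]
  simp

theorem curryLeft_wedgeOneL {k : ℕ} (θ : V [⋀^Fin 1]→L[ℝ] ℝ) (α : V [⋀^Fin (k + 1)]→L[ℝ] ℝ)
    (x : V) :
    (wedgeOneL V (k + 1) θ α).curryLeft x = θ ![x] • α - wedgeOneL V k θ (α.curryLeft x) := by
  ext v
  change wedgeOneL V (k + 1) θ α (Fin.cons x v) = (θ ![x] • α) v - wedgeOneL V k θ (α.curryLeft x) v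
  rw [coe_wedgeOneL, altSum_cons, coe_wedgeOneL]
  rfl

theorem coe_wedgeTwoL' {k : ℕ} (ω : V [⋀^Fin 2]→L[ℝ] ℝ) (α : V [⋀^Fin k]→L[ℝ] ℝ) :
    ⇑(wedgeTwoL V k ω α) =
      (1 / 2 : ℝ) • altSum fun x => ⇑(wedgeOneL V k (contractTwo ω x) α) := by
  rw [coe_wedgeTwoL]
  simp only [coe_wedgeOneL, contractTwo_apply]

theorem altSum_contractTwo_flip {k : ℕ} (ω : V [⋀^Fin 2]→L[ℝ] ℝ) (α : V [⋀^Fin k]→L[ℝ] ℝ)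
    (x : V) : (altSum fun y => contractTwo ω y ![x] • ⇑α) =
      -⇑(wedgeOneL V k (contractTwo ω x) α) := by
  rw [coe_wedgeOneL, ← altSum_neg]
  simp only [contractTwo_apply, ← neg_smul, ← twoForm_swap]

theorem curryLeft_wedgeTwoL_zero (ω : V [⋀^Fin 2]→L[ℝ] ℝ) (α : V [⋀^Fin 0]→L[ℝ] ℝ) (x : V) :
    (wedgeTwoL V 0 ω α).curryLeft x = wedgeOneL V 0 (contractTwo ω x) α := by
  ext v
  change wedgeTwoL V 0 ω α (Fin.cons x v) = _
  rw [coe_wedgeTwoL', Pi.smul_apply, altSum_cons]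
  have : (fun (y : V) (u : Fin 0 → V) => wedgeOneL V 0 (contractTwo ω y) α (Fin.cons x u)) =
      fun y => contractTwo ω y ![x] • ⇑α :=
    funext fun y => congrArg DFunLike.coe (curryLeft_wedgeOneL_zero (contractTwo ω y) α x)
  rw [this, altSum_contractTwo_flip, Pi.neg_apply, smul_eq_mul]
  ring

/-- The vector `x` can enter either slot of `ω`, and by antisymmetry both contribute equally, which
absorbs the factor `1 / 2` in the definition of the product. -/
theorem curryLeft_wedgeTwoL {k : ℕ} (ω : V [⋀^Fin 2]→L[ℝ] ℝ) (α : V [⋀^Fin (k + 1)]→L[ℝ] ℝ)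
    (x : V) : (wedgeTwoL V (k + 1) ω α).curryLeft x =
      wedgeOneL V (k + 1) (contractTwo ω x) α + wedgeTwoL V k ω (α.curryLeft x) := by
  ext v
  change wedgeTwoL V (k + 1) ω α (Fin.cons x v) =
    wedgeOneL V (k + 1) (contractTwo ω x) α v + wedgeTwoL V k ω (α.curryLeft x) v
  rw [coe_wedgeTwoL', Pi.smul_apply, altSum_cons]
  have : (fun (y : V) (u : Fin (k + 1) → V) =>
      wedgeOneL V (k + 1) (contractTwo ω y) α (Fin.cons x u)) =
      fun y => contractTwo ω y ![x] • ⇑α - ⇑(wedgeOneL V k (contractTwo ω y) (α.curryLeft x)) :=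
    funext fun y => congrArg DFunLike.coe (curryLeft_wedgeOneL (contractTwo ω y) α x)
  rw [this, altSum_sub, altSum_contractTwo_flip, coe_wedgeTwoL', Pi.sub_apply, Pi.neg_apply,
    Pi.smul_apply, smul_eq_mul, smul_eq_mul]
  ring

/-- The exterior algebra of a vector space, as the product of its graded pieces. -/
abbrev GradedForms (V : Type*) [NormedAddCommGroup V] [NormedSpace ℝ V] : Type _ :=
  (k : ℕ) → V [⋀^Fin k]→L[ℝ] ℝ

namespace GradedForms

/-- The pointwise Lefschetz operator. -/
def lef (ω : V [⋀^Fin 2]→L[ℝ] ℝ) : GradedForms V →ₗ[ℝ] GradedForms V where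
  toFun α := fun
    | 0 => 0
    | 1 => 0
    | k + 2 => wedgeTwoL V k ω (α k)
  map_add' α β := funext fun k => match k with
    | 0 => by simp
    | 1 => by simp
    | k + 2 => by simp
  map_smul' c α := funext fun k => match k with
    | 0 => by simp
    | 1 => by simp
    | k + 2 => by simp

/-- Exterior multiplication by a covector. -/
def ext (θ : V [⋀^Fin 1]→L[ℝ] ℝ) : GradedForms V →ₗ[ℝ] GradedForms V where
  toFun α := fun
    | 0 => 0
    | k + 1 => wedgeOneL V k θ (α k)
  map_add' α β := funext fun k => match k with
    | 0 => by simp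
    | k + 1 => by simp
  map_smul' c α := funext fun k => match k with
    | 0 => by simp
    | k + 1 => by simp

/-- Contraction with a vector. -/
def contract (x : V) : GradedForms V →ₗ[ℝ] GradedForms V where
  toFun α k := (α (k + 1)).curryLeft x
  map_add' _ _ := rfl
  map_smul' _ _ := rfl

theorem contract_ext (x : V) (θ : V [⋀^Fin 1]→L[ℝ] ℝ) (α : GradedForms V) :
    contract x (ext θ α) = θ ![x] • α - ext θ (contract x α) := by
  funext k
  cases k with
  | zero => exact (curryLeft_wedgeOneL_zero θ (α 0) x).trans (sub_zero _).symm
  | succ k => exact curryLeft_wedgeOneL θ (α (k + 1)) x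

theorem contract_lef (x : V) (ω : V [⋀^Fin 2]→L[ℝ] ℝ) (α : GradedForms V) :
    contract x (lef ω α) = ext (contractTwo ω x) α + lef ω (contract x α) := by
  funext k
  match k with
  | 0 => exact (add_zero _).symm
  | 1 => exact (curryLeft_wedgeTwoL_zero ω (α 0) x).trans (add_zero _).symm
  | k + 2 => exact curryLeft_wedgeTwoL ω (α (k + 1)) x

theorem ext_lef (θ : V [⋀^Fin 1]→L[ℝ] ℝ) (ω : V [⋀^Fin 2]→L[ℝ] ℝ) (α : GradedForms V) :
    ext θ (lef ω α) = lef ω (ext θ α) := by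
  funext k
  match k with
  | 0 => rfl
  | 1 => exact map_zero (wedgeOneL V 0 θ)
  | 2 => exact (map_zero (wedgeOneL V 1 θ)).trans (map_zero (wedgeTwoL V 0 ω)).symm
  | k + 3 => exact wedgeOneL_wedgeTwoL θ ω (α k)

/-- Contraction is a derivation over the even form `ω`, and multiplication by `ι_x ω` commutes with
`L`, so each of the `r + 1` factors contributes the same term. This commutator drives the hard
Lefschetz induction. -/
theorem contract_lef_pow (x : V) (ω : V [⋀^Fin 2]→L[ℝ] ℝ) (r : ℕ) (α : GradedForms V) :
    contract x ((lef ω ^ (r + 1)) α) = (lef ω ^ (r + 1)) (contract x α) +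
      ((r : ℝ) + 1) • ext (contractTwo ω x) ((lef ω ^ r) α) := by
  induction r with
  | zero => simp [contract_lef, add_comm]
  | succ r ih =>
    rw [pow_succ', Module.End.mul_apply, contract_lef, ih, map_add, map_smul, ← ext_lef,
      Module.End.mul_apply, ← Module.End.mul_apply (lef ω) (lef ω ^ r), ← pow_succ']
    push_cast
    module

theorem lef_pow_apply_eq_zero (ω : V [⋀^Fin 2]→L[ℝ] ℝ) {α : GradedForms V} {k : ℕ}
    (hα : ∀ j, j ≠ k → α j = 0) (r : ℕ) : ∀ j, j ≠ k + 2 * r → (lef ω ^ r) α j = 0 := by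
  induction r with
  | zero => exact hα
  | succ r ih =>
    rw [pow_succ']
    intro j hj
    match j with
    | 0 => rfl
    | 1 => rfl
    | j + 2 =>
      have := ih j (by omega)
      change wedgeTwoL V j ω ((lef ω ^ r) α j) = 0
      rw [this, map_zero]

variable {N : ℕ} (b : Module.Basis (Fin N) ℝ V)

/-- Euler's identity: `∑ eⁱ ∧ ι_{eᵢ}` counts the degree. -/
theorem sum_ext_contract [FiniteDimensional ℝ V] (ξ : Fin N → V [⋀^Fin 1]→L[ℝ] ℝ)
    (hξ : ∀ i w, ξ i ![w] = b.coord i w) (α : GradedForms V) (k : ℕ) :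
    (∑ i, ext (ξ i) (contract (b i) α)) k = (k : ℝ) • α k := by
  rw [Finset.sum_apply]
  cases k with
  | zero => simp [ext]
  | succ k =>
    change ∑ i, wedgeOneL V k (ξ i) ((α (k + 1)).curryLeft (b i)) = _
    have h := ContinuousAlternatingMap.alternatizeUncurryFin_curryLeft (α (k + 1))
    have h' : ((k + 1 : ℕ) : ℝ) • α (k + 1) = (k + 1) • α (k + 1) := Nat.cast_smul_eq_nsmul ℝ _ _
    rw [h', ← h]
    apply DFunLike.coe_injective
    rw [coe_alternatizeUncurryFin]
    funext v
    rw [ContinuousAlternatingMap.sum_apply]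
    simp only [coe_wedgeOneL, altSum, hξ, Pi.smul_apply, smul_eq_mul]
    rw [Finset.sum_comm]
    refine Finset.sum_congr rfl fun i _ => ?_
    rw [← Finset.mul_sum]
    congr 1
    conv_rhs => rw [← b.sum_repr (v i), map_sum]
    rw [ContinuousAlternatingMap.sum_apply]
    simp

/-- By non-degeneracy the covectors `ι_x ω` include a dual basis. Contracting `eⁱ ∧ β = 0` with `eᵢ`
gives `eⁱ ∧ ι_{eᵢ} β = β` for every `i`; summing, Euler's identity becomes `(dim V) β = k β`, and
only top degree escapes. -/
theorem eq_zero_of_ext_contractTwo [FiniteDimensional ℝ V] {ω : V [⋀^Fin 2]→L[ℝ] ℝ}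
    (hω : ∀ v, (∀ w, ω ![v, w] = 0) → v = 0) {k : ℕ} (hk : k ≠ Module.finrank ℝ V)
    {β : GradedForms V} (hβ : ∀ j, j ≠ k → β j = 0)
    (h : ∀ x, ext (contractTwo ω x) β = 0) : β = 0 := by
  let b := Module.finBasis ℝ V
  let T : V →ₗ[ℝ] Module.Dual ℝ V :=
    { toFun := fun v =>
        { toFun := fun w => ω ![v, w]
          map_add' := fun w w' => (contractTwo ω v).map_vecCons_add ![] w w'
          map_smul' := fun c w => (contractTwo ω v).map_vecCons_smul ![] c w }
      map_add' := fun v v' => LinearMap.ext fun w => ω.map_vecCons_add ![w] v v'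
      map_smul' := fun c v => LinearMap.ext fun w => ω.map_vecCons_smul ![w] c v }
  have hT : Function.Injective T := (injective_iff_map_eq_zero T).2 fun v hv =>
    hω v fun w => congrArg (fun φ : Module.Dual ℝ V => φ w) hv
  have hT' : Function.Surjective T :=
    (LinearMap.injective_iff_surjective_of_finrank_eq_finrank
      (Subspace.dual_finrank_eq (K := ℝ) (V := V)).symm).1 hT
  choose e he using fun i => hT' (b.coord i)
  have hξ : ∀ i w, contractTwo ω (e i) ![w] = b.coord i w := fun i w =>
    congrArg (fun φ : Module.Dual ℝ V => φ w) (he i)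
  have hs := sum_ext_contract b (fun i => contractTwo ω (e i)) hξ β k
  have hc : ∀ i, ext (contractTwo ω (e i)) (contract (b i) β) = β := fun i => by
    have := contract_ext (b i) (contractTwo ω (e i)) β
    rw [h, map_zero, hξ, Module.Basis.coord_apply, Module.Basis.repr_self,
      Finsupp.single_eq_same, one_smul] at this
    exact (sub_eq_zero.1 this.symm).symm
  simp only [hc, Finset.sum_const, Finset.card_univ, Fintype.card_fin] at hs
  have hk0 : β k = 0 := by
    rw [Pi.smul_apply, ← Nat.cast_smul_eq_nsmul ℝ, ← sub_eq_zero, ← sub_smul] at hs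
    refine (smul_eq_zero.1 hs).resolve_left (sub_ne_zero.2 ?_)
    exact_mod_cast hk.symm
  funext j
  by_cases hj : j = k
  · subst hj; exact hk0
  · exact hβ j hj

/-- The hard Lefschetz property: `Lʳ` is injective on `k`-forms if `k + r ≤ n`. -/
theorem eq_zero_of_lef_pow_eq_zero [FiniteDimensional ℝ V] {ω : V [⋀^Fin 2]→L[ℝ] ℝ}
    (hω : ∀ v, (∀ w, ω ![v, w] = 0) → v = 0) {n : ℕ} (hn : Module.finrank ℝ V = 2 * n)
    {k r : ℕ} (hkr : k + r ≤ n) {α : GradedForms V} (hα : ∀ j, j ≠ k → α j = 0)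
    (h : (lef ω ^ r) α = 0) : α = 0 := by
  -- Contracting `L^(r+1) α = 0` with `x` leaves `L^(r+1) (ι_x α) = 0`, since the correction term
  -- contains `L^r α = 0`. This trades one degree for one power and preserves `k + r`. In degree `0`
  -- all contractions vanish, so the correction term alone survives and lowers the power by one.
  induction k generalizing r α with
  | zero =>
    have hc : ∀ x, contract x α = 0 := fun x => funext fun j => by
      change (α (j + 1)).curryLeft x = 0
      rw [hα _ (by omega)]; rfl
    induction r with
    | zero => exact h
    | succ r ih =>
      refine ih (by omega) ?_
      refine eq_zero_of_ext_contractTwo hω (k := 0 + 2 * r) (by omega)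
        (lef_pow_apply_eq_zero ω hα r) fun x => ?_
      have := contract_lef_pow x ω r α
      rw [h, hc, map_zero, map_zero, zero_add] at this
      exact (smul_eq_zero.1 this.symm).resolve_left (by positivity)
  | succ k ih =>
    have h1 : (lef ω ^ (r + 1)) α = 0 := by rw [pow_succ', Module.End.mul_apply, h, map_zero]
    have hc : ∀ x, contract x α = 0 := fun x => by
      refine ih (r := r + 1) (by omega) (fun j hj => ?_) ?_
      · change (α (j + 1)).curryLeft x = 0
        rw [hα _ (by omega)]; rfl
      · have := contract_lef_pow x ω r α
        rw [h1, h, map_zero, map_zero, smul_zero, add_zero] at this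
        exact this.symm
    funext j
    by_cases hj : j = k + 1
    · subst hj
      ext v
      have : (α (k + 1)).curryLeft (v 0) = 0 := congrFun (hc (v 0)) k
      have : α (k + 1) (Fin.cons (v 0) (Fin.tail v)) = 0 := congrArg (fun f => f (Fin.tail v)) this
      rwa [Fin.cons_self_tail] at this
    · exact hα j hj

end GradedForms

end Graded

/-! ### Dimension of the spaces of alternating forms. -/

section Dimension

variable {V : Type*} [NormedAddCommGroup V] [NormedSpace ℝ V] [FiniteDimensional ℝ V]

/-- In a basis the map is a polynomial in coordinates. This transfers the dimension count for
exterior powers to continuous forms. -/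
theorem continuous_alternatingMap {k : ℕ} (f : V [⋀^Fin k]→ₗ[ℝ] ℝ) : Continuous f := by
  let b := Module.finBasis ℝ V
  have h : ∀ v, f v = ∑ r : Fin k → Fin (Module.finrank ℝ V),
      (∏ i, b.coord (r i) (v i)) * f fun i => b (r i) := fun v => by
    conv_lhs => rw [show v = fun i => ∑ j, b.repr (v i) j • b j from
      funext fun i => (b.sum_repr (v i)).symm]
    rw [← AlternatingMap.coe_multilinearMap, MultilinearMap.map_sum]
    refine Finset.sum_congr rfl fun r _ => ?_
    rw [MultilinearMap.map_smul_univ]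
    rfl
  rw [funext h]
  refine continuous_finsetSum _ fun r _ => (continuous_finsetProd _ fun i _ => ?_).mul
    continuous_const
  exact (LinearMap.continuous_of_finiteDimensional (b.coord (r i))).comp (continuous_apply i)

/-- In finite dimension, all alternating maps are continuous. -/
def continuousAlternatingEquiv (V : Type*) [NormedAddCommGroup V] [NormedSpace ℝ V]
    [FiniteDimensional ℝ V] (k : ℕ) : (V [⋀^Fin k]→L[ℝ] ℝ) ≃ₗ[ℝ] (V [⋀^Fin k]→ₗ[ℝ] ℝ) :=
  LinearEquiv.ofBijective ContinuousAlternatingMap.toAlternatingMapLinear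
    ⟨ContinuousAlternatingMap.toAlternatingMap_injective, fun f =>
      ⟨{ f with cont := continuous_alternatingMap f }, rfl⟩⟩

instance finiteDimensional_continuousAlternatingMap (k : ℕ) :
    FiniteDimensional ℝ (V [⋀^Fin k]→L[ℝ] ℝ) :=
  Module.Finite.equiv ((continuousAlternatingEquiv V k).trans
    exteriorPower.alternatingMapLinearEquiv).symm

theorem finrank_continuousAlternatingMap (k : ℕ) :
    Module.finrank ℝ (V [⋀^Fin k]→L[ℝ] ℝ) = (Module.finrank ℝ V).choose k := by
  rw [((continuousAlternatingEquiv V k).trans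
    exteriorPower.alternatingMapLinearEquiv).finrank_eq, ← exteriorPower.finrank_eq (R := ℝ)]
  exact Subspace.dual_finrank_eq

end Dimension

/-! ### Leibniz rules for the exterior derivative in a normed space. -/

section Leibniz

variable {V : Type*} [NormedAddCommGroup V] [NormedSpace ℝ V] {k : ℕ}

theorem extDeriv_wedgeOneL {θ : V → V [⋀^Fin 1]→L[ℝ] ℝ} {α : V → V [⋀^Fin k]→L[ℝ] ℝ} {y : V}
    (hθ : DifferentiableAt ℝ θ y) (hα : DifferentiableAt ℝ α y) (hd : extDeriv θ y = 0) :
    extDeriv (fun z => wedgeOneL V k (θ z) (α z)) y =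
      -wedgeOneL V (k + 1) (θ y) (extDeriv α y) := by
  have h := (wedgeOneL V k).hasFDerivAt_of_bilinear hθ.hasFDerivAt hα.hasFDerivAt
  have hT : (altSum fun x => ⇑(fderiv ℝ θ y x)) = 0 := by
    rw [← coe_alternatizeUncurryFin]; exact congrArg DFunLike.coe hd
  apply DFunLike.coe_injective
  rw [extDeriv, h.fderiv, coe_alternatizeUncurryFin, ContinuousAlternatingMap.coe_neg,
    coe_wedgeOneL, extDeriv, coe_alternatizeUncurryFin, ← altSum_wedgeOneL]
  have h0 := altSum_wedgeOneL_eq_zero _ hT (α y)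
  rw [← add_zero (altSum fun x => ⇑(wedgeOneL V k (θ y) _)), ← h0, ← altSum_add]
  rfl

/-- The hypothesis says that `T = Dω + θ ⊗ ω` antisymmetrizes to zero, hence so does `T ∧ α`. The
term where the derivative falls on `ω` can therefore be replaced by `-θ ∧ ω ∧ α`, with no general
product of a `3`-form and a `k`-form. -/
theorem extDeriv_wedgeTwoL {ω : V → V [⋀^Fin 2]→L[ℝ] ℝ} {θ : V [⋀^Fin 1]→L[ℝ] ℝ}
    {α : V → V [⋀^Fin k]→L[ℝ] ℝ} {y : V}
    (hω : DifferentiableAt ℝ ω y) (hα : DifferentiableAt ℝ α y)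
    (hd : extDeriv ω y = -wedgeOneL V 2 θ (ω y)) :
    extDeriv (fun z => wedgeTwoL V k (ω z) (α z)) y =
      wedgeTwoL V (k + 1) (ω y) (extDeriv α y) -
        wedgeOneL V (k + 2) θ (wedgeTwoL V k (ω y) (α y)) := by
  have h := (wedgeTwoL V k).hasFDerivAt_of_bilinear hω.hasFDerivAt hα.hasFDerivAt
  have hT : (altSum fun x => ⇑(fderiv ℝ ω y x + θ ![x] • ω y)) = 0 := by
    have : ⇑(extDeriv ω y) = altSum fun x => ⇑(fderiv ℝ ω y x) := coe_alternatizeUncurryFin _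
    simp only [ContinuousAlternatingMap.coe_add, ContinuousAlternatingMap.coe_smul]
    rw [altSum_add, ← this, ← coe_wedgeOneL, hd]
    simp
  have h0 := altSum_wedgeTwoL_eq_zero _ hT (α y)
  simp only [map_add, map_smul, add_apply, smul_apply,
    ContinuousAlternatingMap.coe_add, ContinuousAlternatingMap.coe_smul] at h0
  rw [altSum_add, ← coe_wedgeOneL] at h0
  apply DFunLike.coe_injective
  rw [extDeriv, h.fderiv, coe_alternatizeUncurryFin, ContinuousAlternatingMap.coe_sub,
    coe_wedgeTwoL, extDeriv, coe_alternatizeUncurryFin, ← altSum_wedgeTwoL,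
    ← neg_eq_iff_eq_neg.2 (add_eq_zero_iff_eq_neg.1 h0), sub_neg_eq_add, ← altSum_add]
  rfl

end Leibniz

/-! ### The twisted differential on a manifold and its commutation with `L`. -/

section Manifold

variable {m : ℕ} {M : Type*} [TopologicalSpace M] [ChartedSpace (Model m) M]
  {e : OpenPartialHomeomorph M (Model m)}

theorem localRep_wedgeOneRough {k : ℕ} (θ : RoughForm m M 1) (α : RoughForm m M k) :
    localRep e (wedgeOneRough θ α) =
      fun y => wedgeOneL (Model m) k (localRep e θ y) (localRep e α y) :=
  funext fun y => wedgeOneL_comp (V := Model m) (W := Model m) (θ (e.symm y)) (α (e.symm y)) _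

theorem localRep_wedgeTwoRough {k : ℕ} (ω : RoughForm m M 2) (α : RoughForm m M k) :
    localRep e (wedgeTwoRough ω α) =
      fun y => wedgeTwoL (Model m) k (localRep e ω y) (localRep e α y) :=
  funext fun y => wedgeTwoL_comp (V := Model m) (W := Model m) (ω (e.symm y)) (α (e.symm y)) _

theorem IsSmooth.contDiffAt_localRep {k : ℕ} {α : RoughForm m M k} (hα : IsSmooth α)
    (he : e ∈ atlas (Model m) M) {y : Model m} (hy : y ∈ e.target) :
    ContDiffAt ℝ (⊤ : ℕ∞) (localRep e α) y :=
  (hα e he).contDiffAt (e.open_target.mem_nhds hy)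

theorem IsSmooth.differentiableAt_localRep {k : ℕ} {α : RoughForm m M k} (hα : IsSmooth α)
    (he : e ∈ atlas (Model m) M) {y : Model m} (hy : y ∈ e.target) :
    DifferentiableAt ℝ (localRep e α) y :=
  (hα.contDiffAt_localRep he hy).differentiableAt (by simp)

theorem wedgeOne_wedgeOne {k : ℕ} (θ : Form m M 1) (α : Form m M k) :
    wedgeOne θ (k + 1) (wedgeOne θ k α) = 0 :=
  Subtype.ext <| funext fun x => wedgeOneL_self (V := Model m) (θ.1 x) (α.1 x)

theorem wedgeOne_wedgeTwo {k : ℕ} (θ : Form m M 1) (ω : Form m M 2) (α : Form m M k) :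
    wedgeOne θ (k + 2) (wedgeTwo ω k α) = wedgeTwo ω (k + 1) (wedgeOne θ k α) :=
  Subtype.ext <| funext fun x => wedgeOneL_wedgeTwoL (V := Model m) (θ.1 x) (ω.1 x) (α.1 x)

theorem comp_lef_add_two (ω : Form m M 2) (α : Forms m M) (k : ℕ) :
    Forms.comp (k + 2) (lef ω α) = wedgeTwo ω k (Forms.comp k α) := rfl

variable [IsManifold (𝓡 m) (⊤ : ℕ∞) M]

theorem mfderiv_symm_bijective (he : e ∈ atlas (Model m) M) {y : Model m} (hy : y ∈ e.target) :
    Function.Bijective (mfderiv (𝓡 m) (𝓡 m) e.symm y) := by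
  have : IsManifold (𝓡 m) 1 M := IsManifold.of_le (n := (⊤ : ℕ∞)) (by exact_mod_cast le_top)
  exact (mdifferentiable_of_mem_atlas he).symm.mfderiv_bijective hy

/-- The derivative of an inverse chart is bijective, so no information is lost by pulling back.
Identities for `d` can thus be checked in charts. -/
theorem RoughForm.ext_localRep {k : ℕ} {α β : RoughForm m M k}
    (h : ∀ e ∈ atlas (Model m) M, ∀ y ∈ e.target, localRep e α y = localRep e β y) : α = β := by
  funext x
  set e := chartAt (Model m) x
  have he : e ∈ atlas (Model m) M := chart_mem_atlas _ x
  have hy : e x ∈ e.target := mem_chart_target _ x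
  have hs := (mfderiv_symm_bijective he hy).2
  have hx : e.symm (e x) = x := e.left_inv (mem_chart_source _ x)
  have key : α (e.symm (e x)) = β (e.symm (e x)) := by
    ext v
    choose w hw using fun i => hs (v i)
    have := congrArg (fun f => f w) (h e he _ hy)
    have hv : v = fun i => mfderiv (𝓡 m) (𝓡 m) e.symm (e x) (w i) := funext fun i => (hw i).symm
    rw [hv]
    exact this
  rwa [hx] at key

theorem Form.ext_localRep {k : ℕ} {α β : Form m M k}
    (h : ∀ e ∈ atlas (Model m) M, ∀ y ∈ e.target, localRep e α.1 y = localRep e β.1 y) : α = β :=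
  Subtype.ext (RoughForm.ext_localRep h)

theorem extD_extD {k : ℕ} (α : Form m M k) : extD (k + 1) (extD k α) = 0 := by
  refine Form.ext_localRep fun e he y hy => ?_
  have h1 : localRep e (extDRough α.1) =ᶠ[𝓝 y] extDeriv (localRep e α.1) := by
    filter_upwards [e.open_target.mem_nhds hy] with z hz
    exact localRep_extDRough α.2 he hz
  have : localRep e (extDRough (extDRough α.1)) y = 0 := by
    rw [localRep_extDRough (IsSmooth.extD α.2) he hy, h1.extDeriv_eq,
      extDeriv_extDeriv_apply (α.2.contDiffAt_localRep he hy)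
        (by simp; exact WithTop.coe_le_coe.2 le_top)]
  exact this

theorem extD_wedgeOne {k : ℕ} {θ : Form m M 1} (hθ : extD 1 θ = 0) (α : Form m M k) :
    extD (k + 1) (wedgeOne θ k α) = -wedgeOne θ (k + 1) (extD k α) := by
  refine Form.ext_localRep fun e he y hy => ?_
  have hd : extDeriv (localRep e θ.1) y = 0 := by
    rw [← localRep_extDRough θ.2 he hy]
    exact congrArg (fun β : Form m M 2 => localRep e β.1 y) hθ
  have h1 : localRep e (extDRough (wedgeOneRough θ.1 α.1)) y =
      -localRep e (wedgeOneRough θ.1 (extDRough α.1)) y := by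
    rw [localRep_extDRough (IsSmooth.wedgeOne θ.2 α.2) he hy, localRep_wedgeOneRough,
      localRep_wedgeOneRough, extDeriv_wedgeOneL (θ.2.differentiableAt_localRep he hy)
      (α.2.differentiableAt_localRep he hy) hd, ← localRep_extDRough α.2 he hy]
  exact h1

theorem extD_wedgeTwo {k : ℕ} {ω : Form m M 2} {θ : Form m M 1}
    (hω : extD 2 ω = -wedgeOne θ 2 ω) (α : Form m M k) :
    extD (k + 2) (wedgeTwo ω k α) =
      wedgeTwo ω (k + 1) (extD k α) - wedgeOne θ (k + 2) (wedgeTwo ω k α) := by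
  refine Form.ext_localRep fun e he y hy => ?_
  have hd : extDeriv (localRep e ω.1) y =
      -wedgeOneL (Model m) 2 (localRep e θ.1 y) (localRep e ω.1 y) := by
    rw [← localRep_extDRough ω.2 he hy]
    refine (congrArg (fun β : Form m M 3 => localRep e β.1 y) hω).trans ?_
    exact congrArg Neg.neg (congrFun (localRep_wedgeOneRough (e := e) θ.1 ω.1) y)
  have h1 : localRep e (extDRough (wedgeTwoRough ω.1 α.1)) y =
      localRep e (wedgeTwoRough ω.1 (extDRough α.1)) y -
        localRep e (wedgeOneRough θ.1 (wedgeTwoRough ω.1 α.1)) y := by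
    rw [localRep_extDRough (IsSmooth.wedgeTwo ω.2 α.2) he hy, localRep_wedgeTwoRough,
      localRep_wedgeTwoRough, localRep_wedgeOneRough, localRep_wedgeTwoRough,
      extDeriv_wedgeTwoL (ω.2.differentiableAt_localRep he hy)
      (α.2.differentiableAt_localRep he hy) hd, ← localRep_extDRough α.2 he hy]
  exact h1

theorem comp_lich_succ (θ : Form m M 1) (l : ℤ) (α : Forms m M) (k : ℕ) :
    Forms.comp (k + 1) (lich θ l α) =
      extD k (Forms.comp k α) + (l : ℝ) • wedgeOne θ k (Forms.comp k α) := rfl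

theorem smul_neg_add_smul {W : Type*} [AddCommGroup W] [Module ℝ W] (c : ℝ) (x : W) :
    0 + c • -x + c • (x + c • (0 : W)) = 0 := by simp

theorem lich_lich {θ : Form m M 1} (hθ : extD 1 θ = 0) (l : ℤ) (α : Forms m M) :
    lich θ l (lich θ l α) = 0 := by
  refine Forms.ext fun k => ?_
  match k with
  | 0 => rfl
  | 1 =>
    rw [comp_lich_succ]
    change extD 0 0 + (l : ℝ) • wedgeOne θ 0 0 = _
    simp
  | k + 2 =>
    rw [comp_lich_succ, comp_lich_succ]
    simp only [map_add, map_smul, extD_extD, extD_wedgeOne hθ, wedgeOne_wedgeOne]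
    exact smul_neg_add_smul (W := Form m M (k + 2)) (l : ℝ) _

/-- The term `-θ ∧ ω ∧ α` from `dω` lowers the weight `l` by one; everything else commutes. -/
theorem lich_lef {ω : Form m M 2} {θ : Form m M 1} (hω : extD 2 ω = -wedgeOne θ 2 ω) (l : ℤ)
    (α : Forms m M) : lich θ l (lef ω α) = lef ω (lich θ (l - 1) α) := by
  refine Forms.ext fun k => ?_
  match k with
  | 0 => rfl
  | 1 =>
    rw [comp_lich_succ]
    change extD 0 0 + (l : ℝ) • wedgeOne θ 0 0 = 0
    simp
  | 2 =>
    rw [comp_lich_succ, comp_lef_add_two]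
    change extD 1 0 + (l : ℝ) • wedgeOne θ 1 0 = wedgeTwo ω 0 0
    simp
  | k + 3 =>
    rw [comp_lich_succ, comp_lef_add_two, comp_lef_add_two, comp_lich_succ]
    simp only [map_add, map_smul, extD_wedgeTwo hω, ← wedgeOne_wedgeTwo]
    push_cast
    module

end Manifold

/-! ### Powers of `L` as smooth families of linear maps. -/

section WedgePow

variable {V : Type*} [NormedAddCommGroup V] [NormedSpace ℝ V]

/-- The `r`-th power of exterior multiplication by a `2`-form, on `k`-forms. -/
def wedgePow (V : Type*) [NormedAddCommGroup V] [NormedSpace ℝ V] (k : ℕ)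
    (ω : V [⋀^Fin 2]→L[ℝ] ℝ) :
    (r : ℕ) → (V [⋀^Fin k]→L[ℝ] ℝ) →L[ℝ] (V [⋀^Fin (k + 2 * r)]→L[ℝ] ℝ)
  | 0 => ContinuousLinearMap.id ℝ _
  | r + 1 => (wedgeTwoL V (k + 2 * r) ω).comp (wedgePow V k ω r)

theorem wedgePow_succ_apply (k r : ℕ) (ω : V [⋀^Fin 2]→L[ℝ] ℝ) (α : V [⋀^Fin k]→L[ℝ] ℝ) :
    wedgePow V k ω (r + 1) α = wedgeTwoL V (k + 2 * r) ω (wedgePow V k ω r α) := rfl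

theorem contDiff_wedgePow (k r : ℕ) :
    ContDiff ℝ (⊤ : ℕ∞) fun ω : V [⋀^Fin 2]→L[ℝ] ℝ => wedgePow V k ω r := by
  induction r with
  | zero => exact contDiff_const
  | succ r ih => exact (wedgeTwoL V (k + 2 * r)).contDiff.clm_comp ih

theorem wedgePow_comp {W : Type*} [NormedAddCommGroup W] [NormedSpace ℝ W] (k r : ℕ)
    (ω : V [⋀^Fin 2]→L[ℝ] ℝ) (α : V [⋀^Fin k]→L[ℝ] ℝ) (f : W →L[ℝ] V) :
    (wedgePow V k ω r α).compContinuousLinearMap f =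
      wedgePow W k (ω.compContinuousLinearMap f) r (α.compContinuousLinearMap f) := by
  induction r with
  | zero => rfl
  | succ r ih =>
    rw [wedgePow_succ_apply, wedgePow_succ_apply, ← ih]
    exact wedgeTwoL_comp ω _ f

theorem GradedForms.lef_pow_apply (ω : V [⋀^Fin 2]→L[ℝ] ℝ) (α : GradedForms V) (k r : ℕ) :
    (GradedForms.lef ω ^ r) α (k + 2 * r) = wedgePow V k ω r (α k) := by
  induction r with
  | zero => rfl
  | succ r ih =>
    rw [pow_succ', wedgePow_succ_apply, ← ih]
    rfl

theorem wedgePow_injective [FiniteDimensional ℝ V] {ω : V [⋀^Fin 2]→L[ℝ] ℝ}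
    (hω : ∀ v, (∀ w, ω ![v, w] = 0) → v = 0) {n : ℕ} (hn : Module.finrank ℝ V = 2 * n)
    {k r : ℕ} (hkr : k + r ≤ n) : Function.Injective (wedgePow V k ω r) := by
  refine (injective_iff_map_eq_zero _).2 fun a ha => ?_
  have hs : ∀ j, j ≠ k → (Pi.single k a : GradedForms V) j = 0 := fun j hj => by
    simp [hj]
  have h0 := GradedForms.eq_zero_of_lef_pow_eq_zero hω hn hkr hs <| by
    funext j
    by_cases hj : j = k + 2 * r
    · subst hj
      rw [GradedForms.lef_pow_apply, Pi.single_eq_same, ha]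
      rfl
    · exact GradedForms.lef_pow_apply_eq_zero ω hs r j hj
  have := congrFun h0 k
  rwa [Pi.single_eq_same] at this

/-- Injectivity suffices because complementary degrees have equal dimension, by symmetry of binomial
coefficients. -/
theorem wedgePow_bijective [FiniteDimensional ℝ V] {ω : V [⋀^Fin 2]→L[ℝ] ℝ}
    (hω : ∀ v, (∀ w, ω ![v, w] = 0) → v = 0) {k r : ℕ}
    (hn : Module.finrank ℝ V = 2 * (k + r)) : Function.Bijective (wedgePow V k ω r) := by
  have hi := wedgePow_injective hω hn le_rfl
  refine ⟨hi, (LinearMap.injective_iff_surjective_of_finrank_eq_finrank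
    (f := (wedgePow V k ω r).toLinearMap) ?_).1 hi⟩
  rw [finrank_continuousAlternatingMap, finrank_continuousAlternatingMap, hn]
  exact Nat.choose_symm_of_eq_add (by ring)

theorem wedgePow_isInvertible [FiniteDimensional ℝ V] {ω : V [⋀^Fin 2]→L[ℝ] ℝ}
    (hω : ∀ v, (∀ w, ω ![v, w] = 0) → v = 0) {k r : ℕ}
    (hn : Module.finrank ℝ V = 2 * (k + r)) : (wedgePow V k ω r).IsInvertible :=
  ⟨(LinearEquiv.ofBijective _ (wedgePow_bijective hω hn)).toContinuousLinearEquiv, rfl⟩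

end WedgePow

/-! ### Hard Lefschetz for smooth forms. -/

section Lefschetz

variable {m : ℕ} {M : Type*} [TopologicalSpace M] [ChartedSpace (Model m) M]

/-- The value at a point of a family of forms. -/
def Forms.eval (x : M) (α : Forms m M) : GradedForms (Model m) := fun k => (Forms.comp k α).1 x

theorem Forms.eval_lef (x : M) (ω : Form m M 2) (α : Forms m M) :
    Forms.eval x (lef ω α) = GradedForms.lef (V := Model m) (ω.1 x) (Forms.eval x α) := by
  funext k
  match k with
  | 0 => rfl
  | 1 => rfl
  | k + 2 => rfl

theorem Forms.eval_lef_pow (x : M) (ω : Form m M 2) (r : ℕ) (α : Forms m M) :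
    Forms.eval x ((lef ω ^ r) α) =
      (GradedForms.lef (V := Model m) (ω.1 x) ^ r) (Forms.eval x α) := by
  induction r with
  | zero => rfl
  | succ r ih =>
    rw [pow_succ', Module.End.mul_apply, Forms.eval_lef, ih, ← Module.End.mul_apply, ← pow_succ']

theorem Forms.eval_ext {α β : Forms m M} (h : ∀ x : M, Forms.eval x α = Forms.eval x β) :
    α = β :=
  Forms.ext fun k => Subtype.ext <| funext fun x => congrFun (h x) k

/-- Non-degeneracy of a `2`-form on a manifold. -/
def Nondegenerate (ω : Form m M 2) : Prop :=
  ∀ (x : M) (v : TangentSpace (𝓡 m) x), (∀ w : TangentSpace (𝓡 m) x, ω.1 x ![v, w] = 0) → v = 0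

theorem homog_natCast {k : ℕ} {α : Forms m M} (hα : α ∈ homog m M k) {j : ℕ} (hj : j ≠ k) :
    Forms.comp j α = 0 := hα j (by exact_mod_cast hj)

theorem homog_eq_bot_of_neg {k : ℤ} (hk : k < 0) : homog m M k = ⊥ :=
  (Submodule.eq_bot_iff _).2 fun _ hα => Forms.ext fun j => hα j (by omega)

theorem Form.eq_zero_of_lt {k : ℕ} (hk : m < k) (α : Form m M k) : α = 0 := by
  have h0 : Module.finrank ℝ (Model m [⋀^Fin k]→L[ℝ] ℝ) = 0 := by
    rw [finrank_continuousAlternatingMap, finrank_euclideanSpace_fin, Nat.choose_eq_zero_of_lt hk]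
  have : Subsingleton (Model m [⋀^Fin k]→L[ℝ] ℝ) := Module.finrank_zero_iff.1 h0
  exact Subtype.ext <| funext fun x => Subsingleton.elim (α := Model m [⋀^Fin k]→L[ℝ] ℝ) _ _

theorem homog_eq_bot_of_lt {k : ℤ} (hk : m < k) : homog m M k = ⊥ :=
  (Submodule.eq_bot_iff _).2 fun α hα => Forms.ext fun j => by
    by_cases hj : (j : ℤ) = k
    · exact Form.eq_zero_of_lt (by omega) _
    · exact hα j hj

theorem lef_mem_homog (ω : Form m M 2) {k : ℤ} {α : Forms m M} (hα : α ∈ homog m M k) :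
    lef ω α ∈ homog m M (k + 2) := fun j hj => by
  match j with
  | 0 => rfl
  | 1 => rfl
  | j + 2 => rw [comp_lef_add_two, hα j (by push_cast at hj; omega), map_zero]

theorem lef_pow_mem_homog (ω : Form m M 2) {k : ℤ} {α : Forms m M} (hα : α ∈ homog m M k)
    (r : ℕ) : (lef ω ^ r) α ∈ homog m M (k + 2 * r) := by
  induction r with
  | zero => simpa using hα
  | succ r ih =>
    rw [pow_succ', Module.End.mul_apply, show k + 2 * ((r + 1 : ℕ) : ℤ) = k + 2 * r + 2 by
      push_cast; ring]
    exact lef_mem_homog ω ih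

theorem eq_zero_of_lef_pow_eq_zero {n : ℕ} (hm : m = 2 * n) {ω : Form m M 2}
    (hω : Nondegenerate ω) {k : ℤ} {r : ℕ} (hkr : k + r ≤ n) {α : Forms m M}
    (hα : α ∈ homog m M k) (h : (lef ω ^ r) α = 0) : α = 0 := by
  rcases lt_or_ge k 0 with hk | hk
  · rw [homog_eq_bot_of_neg hk] at hα
    exact hα
  lift k to ℕ using hk
  refine Forms.eval_ext fun x => GradedForms.eq_zero_of_lef_pow_eq_zero (V := Model m)
    (ω := ω.1 x) (hω x) (n := n) (r := r) (by rw [finrank_euclideanSpace_fin, hm])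
    (by exact_mod_cast hkr) (fun j hj => ?_) ?_
  · rw [Forms.eval, homog_natCast hα hj]; rfl
  · rw [← Forms.eval_lef_pow, h]; rfl

/-- A form placed in its degree. -/
def Forms.single (k : ℕ) (a : Form m M k) : Forms m M :=
  Forms.mk fun j => if h : k = j then h ▸ a else 0

theorem Forms.comp_single_same (k : ℕ) (a : Form m M k) :
    Forms.comp k (Forms.single k a) = a := by simp [Forms.single]

theorem Forms.single_mem_homog (k : ℕ) (a : Form m M k) : Forms.single k a ∈ homog m M k :=
  fun j hj => by simp [Forms.single, show ¬ k = j by rintro rfl; exact hj rfl]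

variable [IsManifold (𝓡 m) (⊤ : ℕ∞) M]

theorem lich_mem_homog (θ : Form m M 1) (l : ℤ) {k : ℤ} {α : Forms m M} (hα : α ∈ homog m M k) :
    lich θ l α ∈ homog m M (k + 1) := fun j hj => by
  match j with
  | 0 => rfl
  | j + 1 =>
    rw [comp_lich_succ, hα j (by push_cast at hj; omega), map_zero, map_zero, smul_zero, add_zero]

theorem nondegenerate_localRep {ω : Form m M 2} (hω : Nondegenerate ω)
    {e : OpenPartialHomeomorph M (Model m)} (he : e ∈ atlas (Model m) M) {y : Model m}
    (hy : y ∈ e.target) (v : Model m) (h : ∀ w, localRep e ω.1 y ![v, w] = 0) : v = 0 := by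
  obtain ⟨hi, hs⟩ := mfderiv_symm_bijective he hy
  refine hi ((hω _ _ fun w => ?_).trans (map_zero _).symm)
  obtain ⟨w, rfl⟩ := hs w
  have := h w
  rw [localRep] at this
  refine Eq.trans (congrArg (ω.1 (e.symm y)) ?_) this
  ext i : 1; fin_cases i <;> rfl

/-- The inverse of a power of `L` between complementary degrees preserves smoothness. -/
theorem exists_wedgePow_eq {ω : Form m M 2} (hω : Nondegenerate ω) {k r : ℕ}
    (hm : m = 2 * (k + r)) (β : Form m M (k + 2 * r)) :
    ∃ γ : Form m M k, ∀ x, wedgePow (Model m) k (ω.1 x) r (γ.1 x) = β.1 x := by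
  have hV : Module.finrank ℝ (Model m) = 2 * (k + r) := by rw [finrank_euclideanSpace_fin, hm]
  -- The preimage is taken point by point. Its smoothness is recovered in charts, where it is the
  -- inverse of a smooth family of invertible operators applied to a smooth form, and inversion is
  -- smooth.
  choose γ hγ using fun x => (wedgePow_bijective (V := Model m) (ω := ω.1 x) (hω x) hV).2 (β.1 x)
  refine ⟨⟨γ, fun e he => ?_⟩, hγ⟩
  have hinv : ∀ y ∈ e.target, (wedgePow (Model m) k (localRep e ω.1 y) r).IsInvertible :=
    fun y hy => wedgePow_isInvertible (nondegenerate_localRep hω he hy) hV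
  have hloc : ∀ y ∈ e.target, localRep e γ y =
      (wedgePow (Model m) k (localRep e ω.1 y) r).inverse (localRep e β.1 y) := fun y hy => by
    have h1 : wedgePow (Model m) k (localRep e ω.1 y) r (localRep e γ y) = localRep e β.1 y := by
      let D : Model m →L[ℝ] Model m := mfderiv (𝓡 m) (𝓡 m) e.symm y
      refine (wedgePow_comp (V := Model m) (W := Model m) k r (ω.1 (e.symm y)) (γ (e.symm y))
        D).symm.trans ?_
      exact congrArg (fun f : Model m [⋀^Fin (k + 2 * r)]→L[ℝ] ℝ => f.compContinuousLinearMap D)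
        (hγ (e.symm y))
    rw [← h1]
    exact ((hinv y hy).inverse_apply_eq.2 rfl).symm
  refine ContDiffOn.congr (fun y hy => ?_) hloc
  have hs : ContDiffAt ℝ (⊤ : ℕ∞) (fun y => wedgePow (Model m) k (localRep e ω.1 y) r) y :=
    (contDiff_wedgePow (V := Model m) k r).contDiffAt.comp y (ω.2.contDiffAt_localRep he hy)
  exact (((hinv y hy).contDiffAt_map_inverse.comp y hs).clm_apply
    (β.2.contDiffAt_localRep he hy)).contDiffWithinAt

theorem exists_lef_pow_eq {n : ℕ} (hm : m = 2 * n) {ω : Form m M 2} (hω : Nondegenerate ω)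
    {k : ℤ} {r : ℕ} (hkr : k + r = n) {β : Forms m M} (hβ : β ∈ homog m M (n + r)) :
    ∃ γ ∈ homog m M k, (lef ω ^ r) γ = β := by
  rcases lt_or_ge k 0 with hk | hk
  -- For `k < 0` the degree `n + r = 2n - k` exceeds the dimension, so there is nothing to hit.
  · rw [homog_eq_bot_of_lt (by omega)] at hβ
    exact ⟨0, zero_mem _, (map_zero _).trans ((Submodule.mem_bot ℝ).1 hβ).symm⟩
  lift k to ℕ using hk
  obtain ⟨γ, hγ⟩ := exists_wedgePow_eq hω (k := k) (r := r) (by omega) (Forms.comp _ β)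
  refine ⟨Forms.single k γ, Forms.single_mem_homog k γ, Forms.ext fun j => ?_⟩
  by_cases hj : j = k + 2 * r
  · subst hj
    refine Subtype.ext <| funext fun x => ?_
    have h1 := congrFun (Forms.eval_lef_pow x ω r (Forms.single k γ)) (k + 2 * r)
    have h2 := GradedForms.lef_pow_apply (V := Model m) (ω.1 x)
      (Forms.eval x (Forms.single k γ)) k r
    have h3 : Forms.eval x (Forms.single k γ) k = γ.1 x :=
      congrArg (fun a : Form m M k => a.1 x) (Forms.comp_single_same k γ)
    rw [h3] at h2
    exact (h1.trans h2).trans (hγ x)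
  · rw [lef_pow_mem_homog ω (Forms.single_mem_homog k γ) r j (by omega), hβ j (by omega)]

end Lefschetz

/-! ### Homogeneous components. -/

section Parts

variable {m : ℕ} {M : Type*} [TopologicalSpace M] [ChartedSpace (Model m) M]

theorem homog_of_eq {i j : ℤ} (h : i = j) {α : Forms m M} (hα : α ∈ homog m M i) :
    α ∈ homog m M j := h ▸ hα

/-- The component of degree `k ∈ ℤ`, as an endomorphism of `Ω*(M)`. -/
def part (k : ℤ) : Forms m M →ₗ[ℝ] Forms m M where
  toFun α := Forms.mk fun j => if (j : ℤ) = k then Forms.comp j α else 0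
  map_add' α β := Forms.ext fun j => by
    rw [map_add, Forms.comp_mk, Forms.comp_mk, Forms.comp_mk]
    split_ifs
    · exact map_add _ _ _
    · exact (add_zero _).symm
  map_smul' c α := Forms.ext fun j => by
    rw [map_smul, Forms.comp_mk, Forms.comp_mk]
    split_ifs
    · exact map_smul _ _ _
    · exact (smul_zero _).symm

theorem comp_part (k : ℤ) (j : ℕ) (α : Forms m M) :
    Forms.comp j (part k α) = if (j : ℤ) = k then Forms.comp j α else 0 := rfl

theorem part_mem_homog (k : ℤ) (α : Forms m M) : part k α ∈ homog m M k := fun j hj => by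
  rw [comp_part, if_neg hj]

theorem part_of_mem {k : ℤ} {α : Forms m M} (hα : α ∈ homog m M k) : part k α = α :=
  Forms.ext fun j => by
    rw [comp_part]
    split_ifs with h
    · rfl
    · exact (hα j h).symm

theorem part_of_mem_ne {i k : ℤ} (hik : i ≠ k) {α : Forms m M} (hα : α ∈ homog m M i) :
    part k α = 0 :=
  Forms.ext fun j => by
    rw [comp_part]
    split_ifs with h
    · exact hα j (by omega)
    · rfl

theorem eq_zero_of_part {α : Forms m M} (h : ∀ k : ℕ, part (k : ℤ) α = 0) : α = 0 :=
  Forms.ext fun j => by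
    have := congrArg (Forms.comp j) (h j)
    rwa [comp_part, if_pos rfl] at this

theorem comp_lef_zero (ω : Form m M 2) (α : Forms m M) : Forms.comp 0 (lef ω α) = 0 := rfl

theorem comp_lef_one (ω : Form m M 2) (α : Forms m M) : Forms.comp 1 (lef ω α) = 0 := rfl

theorem part_lef (ω : Form m M 2) (k : ℤ) (α : Forms m M) :
    part (k + 2) (lef ω α) = lef ω (part k α) := by
  refine Forms.ext fun j => ?_
  by_cases hj : (j : ℤ) = k + 2
  · rw [comp_part, if_pos hj]
    match j with
    | 0 => rw [comp_lef_zero, comp_lef_zero]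
    | 1 => rw [comp_lef_one, comp_lef_one]
    | j + 2 =>
      rw [comp_lef_add_two, comp_lef_add_two, comp_part, if_pos (by push_cast at hj; omega)]
  · rw [comp_part, if_neg hj]
    exact (lef_mem_homog ω (part_mem_homog k α) j hj).symm

theorem part_lef_pow (ω : Form m M 2) (k : ℤ) (r : ℕ) (α : Forms m M) :
    part (k + 2 * r) ((lef ω ^ r) α) = (lef ω ^ r) (part k α) := by
  induction r with
  | zero => simp
  | succ r ih =>
    rw [pow_succ', Module.End.mul_apply, Module.End.mul_apply, ← ih, ← part_lef]
    congr 2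
    push_cast
    ring

theorem exists_homog_of_mem_range {ω : Form m M 2} {r : ℕ} {k j : ℤ} (h : k + 2 * r = j)
    {α : Forms m M} (hα : α ∈ homog m M j) (hr : α ∈ LinearMap.range (lef ω ^ r)) :
    ∃ β ∈ homog m M k, (lef ω ^ r) β = α := by
  obtain ⟨β, rfl⟩ := hr
  subst h
  exact ⟨part k β, part_mem_homog k β, by rw [← part_lef_pow, part_of_mem hα]⟩

theorem sum_part (α : Forms m M) : ∑ k ∈ Finset.range (m + 1), part (k : ℤ) α = α := by
  refine Forms.ext fun j => ?_
  rw [map_sum]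
  by_cases hj : j ≤ m
  · rw [Finset.sum_eq_single_of_mem j (Finset.mem_range.2 (by omega))]
    · rw [comp_part, if_pos rfl]
    · intro k _ hk
      rw [comp_part, if_neg (by exact_mod_cast hk.symm)]
  · rw [Form.eq_zero_of_lt (by omega) (Forms.comp j α)]
    exact Form.eq_zero_of_lt (by omega) _

end Parts

/-! ### Lefschetz decomposition and the operators `d⁺`, `d⁻`. -/

section LefschetzDecomposition

variable {n : ℕ} {M : Type*} [TopologicalSpace M] [ChartedSpace (Model (2 * n)) M]
  {ω : Form (2 * n) M 2}

theorem lef_pow_succ_apply {m : ℕ} {M : Type*} [TopologicalSpace M] [ChartedSpace (Model m) M]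
    (ω : Form m M 2) (r : ℕ) (α : Forms m M) :
    (lef ω ^ (r + 1)) α = (lef ω ^ r) (lef ω α) := by
  rw [pow_succ, Module.End.mul_apply]

theorem prim_le_homog (ω : Form (2 * n) M 2) (k : ℤ) : prim ω k ≤ homog (2 * n) M k := by
  rw [prim]
  split_ifs
  · exact inf_le_left
  · exact bot_le

/-- Allowing `r = 0` includes degree `n + 1`, where there are no nonzero primitive forms. This
boundary case is what lets `d⁺` of a form of degree `n` be treated uniformly. -/
theorem mem_prim {k : ℤ} {r : ℕ} (h : k + r = n + 1) {x : Forms (2 * n) M}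
    (hx : x ∈ homog (2 * n) M k) : x ∈ prim ω k ↔ (lef ω ^ r) x = 0 := by
  rw [prim]
  split_ifs with hk
  · rw [show (((n : ℤ) - k + 1).toNat) = r by omega]
    exact ⟨fun h => h.2, fun h => ⟨hx, h⟩⟩
  · obtain rfl : r = 0 := by omega
    exact Iff.rfl

theorem lef_pow_eq_zero_of_mem_prim {k : ℤ} {r : ℕ} (h : k + r = n + 1) {x : Forms (2 * n) M}
    (hx : x ∈ prim ω k) : (lef ω ^ r) x = 0 :=
  (mem_prim h (prim_le_homog ω k hx)).1 hx

theorem eq_zero_of_lef_eq_zero (hω : Nondegenerate ω) {k : ℤ} (hk : k + 1 ≤ n)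
    {α : Forms (2 * n) M} (hα : α ∈ homog (2 * n) M k) (h : lef ω α = 0) : α = 0 :=
  eq_zero_of_lef_pow_eq_zero rfl hω (r := 1) (by exact_mod_cast hk) hα (by rwa [pow_one])

theorem prim_eq_bot {k : ℤ} (hk : n < k) : prim ω k = ⊥ := if_neg (by omega)

theorem part_mem_prim {x : Forms (2 * n) M} (hx : x ∈ primTotal ω) (k : ℤ) :
    part k x ∈ prim ω k := by
  have : primTotal ω ≤ (prim ω k).comap (part k) := iSup_le fun i y hy => by
    rw [Submodule.mem_comap]
    by_cases hik : i = k
    · subst hik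
      rwa [part_of_mem (prim_le_homog ω i hy)]
    · rw [part_of_mem_ne hik (prim_le_homog ω i hy)]
      exact zero_mem _
  exact this hx

/-- With `r = n - k + 1`, primitivity of `L γ` reads `L^(r+1) γ = 0` in degree `k - 2`; since `(k -
2) + (r + 1) = n`, hard Lefschetz just applies. -/
theorem eq_zero_of_mem_prim_of_eq_lef (hω : Nondegenerate ω) {k : ℤ} {x γ : Forms (2 * n) M}
    (hx : x ∈ prim ω k) (hγ : γ ∈ homog (2 * n) M (k - 2)) (h : x = lef ω γ) : x = 0 := by
  rcases le_or_gt k n with hk | hk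
  · obtain ⟨r, hr⟩ : ∃ r : ℕ, k + r = n + 1 := ⟨(n + 1 - k).toNat, by omega⟩
    have h0 := lef_pow_eq_zero_of_mem_prim hr hx
    rw [h, ← lef_pow_succ_apply] at h0
    rw [h, eq_zero_of_lef_pow_eq_zero rfl hω (by push_cast; omega) hγ h0, map_zero]
  · rw [prim_eq_bot hk] at hx
    exact hx

/-- Injectivity of `L` on low degrees, checked one component at a time, provides a linear left
inverse, so the default branch is never taken. -/
theorem lefInv_lef (hω : Nondegenerate ω) {α : Forms (2 * n) M} (hα : α ∈ lowForms n M) :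
    lefInv ω (lef ω α) = α := by
  have hex : ∃ T : Forms (2 * n) M →ₗ[ℝ] Forms (2 * n) M,
      ∀ α ∈ lowForms n M, T (lef ω α) = α := by
    obtain ⟨g, hg⟩ := (lef ω ∘ₗ (lowForms n M).subtype).exists_leftInverse_of_injective <| by
      refine LinearMap.ker_eq_bot'.2 fun β hβ => Subtype.ext (eq_zero_of_part fun k => ?_)
      rcases lt_or_ge k n with hk | hk
      · refine eq_zero_of_lef_eq_zero hω (by omega) (part_mem_homog (k : ℤ) β.1) ?_
        rw [← part_lef]
        exact (congrArg _ hβ).trans (map_zero _)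
      · refine Forms.ext fun j => ?_
        rw [comp_part]
        split_ifs with h
        · exact β.2 j (by omega)
        · rfl
    exact ⟨(lowForms n M).subtype ∘ₗ g, fun α hα =>
      congrArg Subtype.val (LinearMap.congr_fun hg ⟨α, hα⟩)⟩
  rw [lefInv, dif_pos hex]
  exact hex.choose_spec α hα

theorem mem_lowForms {k : ℤ} (hk : k + 1 ≤ n) {α : Forms (2 * n) M}
    (hα : α ∈ homog (2 * n) M k) : α ∈ lowForms n M := fun j hj => hα j (by omega)

variable [IsManifold (𝓡 (2 * n)) (⊤ : ℕ∞) M]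

/-- For `k ≤ n` and `r = n - k + 1`, the form `L^r α` lies in degree `n + (r + 1)`, so it equals
`L^(r+1) γ`; subtracting `L γ` from `α` makes it primitive. For `k > n` the form `α` is itself in
the image of `L^(k-n)`, and its primitive part is zero. -/
theorem exists_prim_add_lef (hω : Nondegenerate ω) {k : ℤ} {α : Forms (2 * n) M}
    (hα : α ∈ homog (2 * n) M k) :
    ∃ x ∈ prim ω k, ∃ γ ∈ homog (2 * n) M (k - 2), α = x + lef ω γ := by
  rcases le_or_gt k n with hk | hk
  · obtain ⟨r, hr⟩ : ∃ r : ℕ, k + r = n + 1 := ⟨(n + 1 - k).toNat, by omega⟩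
    obtain ⟨γ, hγ, h⟩ := exists_lef_pow_eq rfl hω (k := k - 2) (r := r + 1) (by push_cast; omega)
      (homog_of_eq (by push_cast; omega) (lef_pow_mem_homog ω hα r))
    refine ⟨α - lef ω γ, ?_, γ, hγ, by abel⟩
    have hL : lef ω γ ∈ homog (2 * n) M k := homog_of_eq (by ring) (lef_mem_homog ω hγ)
    rw [mem_prim hr (sub_mem hα hL), map_sub, ← lef_pow_succ_apply, h, sub_self]
  · obtain ⟨r, hr⟩ : ∃ r : ℕ, n + (r + 1 : ℤ) = k := ⟨(k - n - 1).toNat, by omega⟩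
    obtain ⟨γ, hγ, h⟩ := exists_lef_pow_eq rfl hω (k := n - (r + 1)) (r := r + 1)
      (by push_cast; omega) (homog_of_eq (by push_cast; omega) hα)
    refine ⟨0, zero_mem _, (lef ω ^ r) γ, homog_of_eq (by omega) (lef_pow_mem_homog ω hγ r), ?_⟩
    rw [zero_add, ← h, pow_succ', Module.End.mul_apply]

theorem isCompl_primTotal (hω : Nondegenerate ω) :
    IsCompl (primTotal ω) (LinearMap.range (lef ω)) := by
  refine ⟨Submodule.disjoint_def.2 fun x hx hr => ?_, ?_⟩
  · obtain ⟨γ, rfl⟩ := hr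
    refine eq_zero_of_part fun k => ?_
    refine eq_zero_of_mem_prim_of_eq_lef hω (part_mem_prim hx k) (part_mem_homog _ γ) ?_
    rw [← part_lef]
    congr 2
    ring
  · rw [codisjoint_iff, Submodule.eq_top_iff']
    intro α
    rw [← sum_part α]
    refine sum_mem fun k _ => ?_
    obtain ⟨x, hx, γ, -, h⟩ := exists_prim_add_lef hω (part_mem_homog (k : ℤ) α)
    rw [h]
    exact Submodule.add_mem_sup (Submodule.mem_iSup_of_mem (k : ℤ) hx) ⟨γ, rfl⟩

theorem primProj_of_mem_prim (hω : Nondegenerate ω) {k : ℤ} {x : Forms (2 * n) M}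
    (hx : x ∈ prim ω k) : primProj ω x = x := by
  rw [primProj, dif_pos (isCompl_primTotal hω)]
  exact Submodule.projection_apply_of_mem_left _ (Submodule.mem_iSup_of_mem k hx)

theorem primProj_lef (hω : Nondegenerate ω) (γ : Forms (2 * n) M) : primProj ω (lef ω γ) = 0 := by
  rw [primProj, dif_pos (isCompl_primTotal hω), Submodule.projection_apply_eq_zero_iff]
  exact ⟨γ, rfl⟩

theorem primProj_add_lef (hω : Nondegenerate ω) {k : ℤ} {x : Forms (2 * n) M}
    (hx : x ∈ prim ω k) (γ : Forms (2 * n) M) : primProj ω (x + lef ω γ) = x := by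
  rw [map_add, primProj_of_mem_prim hω hx, primProj_lef hω, add_zero]

/-- The Lefschetz decomposition of a homogeneous form. -/
theorem exists_eq_primProj_add_lef (hω : Nondegenerate ω) {k : ℤ} {α : Forms (2 * n) M}
    (hα : α ∈ homog (2 * n) M k) : primProj ω α ∈ prim ω k ∧
      ∃ γ ∈ homog (2 * n) M (k - 2), α = primProj ω α + lef ω γ := by
  obtain ⟨x, hx, γ, hγ, h⟩ := exists_prim_add_lef hω hα
  have hp : primProj ω α = x := by rw [h, primProj_add_lef hω hx]
  rw [hp]
  exact ⟨hx, γ, hγ, h⟩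

/-- Uniqueness of the decomposition: later computations of `d⁺` and `d⁻` merely exhibit some
splitting and quote this. -/
theorem dPlus_dMinus_of_eq (hω : Nondegenerate ω) {θ : Form (2 * n) M 1} {l i j : ℤ}
    {α x γ : Forms (2 * n) M} (hx : x ∈ prim ω j) (hγ : γ ∈ homog (2 * n) M i) (hi : i + 1 ≤ n)
    (h : lich θ l α = x + lef ω γ) : dPlus ω θ l α = x ∧ dMinus ω θ l α = γ := by
  have h1 : dPlus ω θ l α = x := by
    rw [dPlus, LinearMap.comp_apply, h, primProj_add_lef hω hx]
  refine ⟨h1, ?_⟩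
  rw [dMinus, LinearMap.comp_apply, LinearMap.sub_apply, h1, h, add_sub_cancel_left,
    lefInv_lef hω (mem_lowForms hi hγ)]

/-- The decomposition `d_l = d_l⁺ + L d_l⁻` in degrees at most `n`. -/
theorem lich_eq_dPlus_add (hω : Nondegenerate ω) (θ : Form (2 * n) M 1) (l : ℤ) {k : ℤ}
    (hk : k ≤ n) {α : Forms (2 * n) M} (hα : α ∈ homog (2 * n) M k) :
    dPlus ω θ l α ∈ prim ω (k + 1) ∧ dMinus ω θ l α ∈ homog (2 * n) M (k - 1) ∧
      lich θ l α = dPlus ω θ l α + lef ω (dMinus ω θ l α) := by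
  obtain ⟨x, hx, γ, hγ, h⟩ := exists_prim_add_lef hω (lich_mem_homog θ l hα)
  replace hγ := homog_of_eq (show k + 1 - 2 = k - 1 by ring) hγ
  obtain ⟨h1, h2⟩ := dPlus_dMinus_of_eq hω hx hγ (by omega) h
  rw [h1, h2]
  exact ⟨hx, hγ, h⟩

theorem lich_lef_pow {θ : Form (2 * n) M 1} (hd : extD 2 ω = -wedgeOne θ 2 ω) (l : ℤ) (r : ℕ)
    (α : Forms (2 * n) M) : lich θ (l + r) ((lef ω ^ r) α) = (lef ω ^ r) (lich θ l α) := by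
  induction r with
  | zero => simp
  | succ r ih =>
    rw [pow_succ', Module.End.mul_apply, Module.End.mul_apply, lich_lef hd, ← ih]
    congr 3
    push_cast
    ring

theorem dPlus_lef (hω : Nondegenerate ω) {θ : Form (2 * n) M 1}
    (hd : extD 2 ω = -wedgeOne θ 2 ω) (l : ℤ) (γ : Forms (2 * n) M) :
    dPlus ω θ l (lef ω γ) = 0 := by
  rw [dPlus, LinearMap.comp_apply, lich_lef hd, primProj_lef hω]

theorem dMinus_lef (hω : Nondegenerate ω) {θ : Form (2 * n) M 1}
    (hd : extD 2 ω = -wedgeOne θ 2 ω) (l : ℤ) {i : ℤ} (hi : i + 2 ≤ n) {γ : Forms (2 * n) M}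
    (hγ : γ ∈ homog (2 * n) M i) : dMinus ω θ l (lef ω γ) = lich θ (l - 1) γ :=
  (dPlus_dMinus_of_eq hω (zero_mem (prim ω 0)) (lich_mem_homog θ (l - 1) hγ) (by omega)
    (by rw [lich_lef hd, zero_add])).2

theorem dMinus_of_lich_eq_zero {θ : Form (2 * n) M 1} {l : ℤ} {α : Forms (2 * n) M}
    (h : lich θ l α = 0) : dMinus ω θ l α = 0 := by
  rw [dMinus, LinearMap.comp_apply, LinearMap.sub_apply, dPlus, LinearMap.comp_apply, h, map_zero,
    sub_zero, map_zero]

theorem lef_pow_lich_of_add_eq (hω : Nondegenerate ω) (θ : Form (2 * n) M 1) (l : ℤ) {k : ℤ}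
    {r : ℕ} (hr : k + r = n) {α : Forms (2 * n) M} (hα : α ∈ homog (2 * n) M k) :
    (lef ω ^ r) (lich θ l α) = (lef ω ^ (r + 1)) (dMinus ω θ l α) := by
  obtain ⟨h1, -, h3⟩ := lich_eq_dPlus_add hω θ l (by omega) hα
  rw [h3, map_add, lef_pow_eq_zero_of_mem_prim (by omega) h1, zero_add, lef_pow_succ_apply]

/-- For `r = n - k`, the power `L^r` kills the primitive part of `d_l α` in degree `k + 1`, while
`L^(r+1)` is injective in degree `k - 1`. The kernel of `d⁻` is thereby described without any
projection. -/
theorem dMinus_eq_zero_iff (hω : Nondegenerate ω) (θ : Form (2 * n) M 1) (l : ℤ) {k : ℤ}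
    {r : ℕ} (hr : k + r = n) {α : Forms (2 * n) M} (hα : α ∈ homog (2 * n) M k) :
    dMinus ω θ l α = 0 ↔ (lef ω ^ r) (lich θ l α) = 0 := by
  rw [lef_pow_lich_of_add_eq hω θ l hr hα]
  refine ⟨fun h => by rw [h, map_zero], fun h => ?_⟩
  exact eq_zero_of_lef_pow_eq_zero rfl hω (by push_cast; omega)
    (lich_eq_dPlus_add hω θ l (by omega) hα).2.1 h

end LefschetzDecomposition

/-! ### Maps between subquotients and exactness on representatives. -/

section SubQuot

variable {V : Type*} [AddCommGroup V] [Module ℝ V] {A B A' B' A'' B'' : Submodule ℝ V}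

theorem SubQuot.cls_eq_iff {x y : V} (hx : x ∈ A) (hy : y ∈ A) :
    (SubQuot.cls x hx : SubQuot A B) = SubQuot.cls y hy ↔ x - y ∈ B := by
  rw [SubQuot.cls, SubQuot.cls, Submodule.mkQ_apply, Submodule.mkQ_apply, Submodule.Quotient.eq]
  exact Iff.rfl

theorem SubQuot.cls_eq_zero_iff {x : V} (hx : x ∈ A) :
    (SubQuot.cls x hx : SubQuot A B) = 0 ↔ x ∈ B := by
  rw [SubQuot.cls, Submodule.mkQ_apply, Submodule.Quotient.mk_eq_zero]
  exact Iff.rfl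

/-- The class of `f x` is a surjection from `S`, and the class of `g x` kills its kernel, hence
factors through it. -/
theorem exists_isGivenBy {S : Submodule ℝ V} {f g : V →ₗ[ℝ] V} (hf : ∀ x ∈ S, f x ∈ A)
    (hg : ∀ x ∈ S, g x ∈ A') (hrep : ∀ a ∈ A, ∃ x ∈ S, a - f x ∈ B)
    (hker : ∀ x ∈ S, f x ∈ B → g x ∈ B') :
    ∃ φ : SubQuot A B →ₗ[ℝ] SubQuot A' B', IsGivenBy φ S f g := by
  let F : S →ₗ[ℝ] SubQuot A B := (B.submoduleOf A).mkQ ∘ₗ f.restrict hf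
  let G : S →ₗ[ℝ] SubQuot A' B' := (B'.submoduleOf A').mkQ ∘ₗ g.restrict hg
  have hF : ∀ x : S, F x = SubQuot.cls (f x) (hf x x.2) := fun _ => rfl
  have hG : ∀ x : S, G x = SubQuot.cls (g x) (hg x x.2) := fun _ => rfl
  have hsurj : ∀ c : SubQuot A B, ∃ x : S, F x = c := fun c => by
    obtain ⟨⟨a, ha⟩, rfl⟩ := (B.submoduleOf A).mkQ_surjective c
    obtain ⟨x, hx, h⟩ := hrep a ha
    exact ⟨⟨x, hx⟩, ((SubQuot.cls_eq_iff ha (hf x hx)).2 h).symm⟩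
  have hle : LinearMap.ker F ≤ LinearMap.ker G := fun x hx => by
    rw [LinearMap.mem_ker, hF, SubQuot.cls_eq_zero_iff] at hx
    rw [LinearMap.mem_ker, hG, SubQuot.cls_eq_zero_iff]
    exact hker x x.2 hx
  let e := F.quotKerEquivOfSurjective hsurj
  refine ⟨(LinearMap.ker F).liftQ G hle ∘ₗ e.symm.toLinearMap, fun c => ?_, fun x hx => ?_⟩
  · obtain ⟨x, rfl⟩ := hsurj c
    exact ⟨x, x.2, hf x x.2, hF x⟩
  · refine ⟨hf x hx, hg x hx, ?_⟩
    have : e.symm (F ⟨x, hx⟩) = (LinearMap.ker F).mkQ ⟨x, hx⟩ := by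
      rw [LinearEquiv.symm_apply_eq]; rfl
    change (LinearMap.ker F).liftQ G hle (e.symm (F ⟨x, hx⟩)) = _
    rw [this]
    rfl

theorem exists_isInducedBy {g : V →ₗ[ℝ] V} (hg : ∀ x ∈ A, g x ∈ A')
    (hker : ∀ x ∈ A, x ∈ B → g x ∈ B') :
    ∃ φ : SubQuot A B →ₗ[ℝ] SubQuot A' B', IsInducedBy φ g :=
  exists_isGivenBy (fun _ hx => hx) hg (fun a ha => ⟨a, ha, by simp⟩) hker

theorem IsGivenBy.exact {φ : SubQuot A B →ₗ[ℝ] SubQuot A' B'}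
    {ψ : SubQuot A' B' →ₗ[ℝ] SubQuot A'' B''} {S S' : Submodule ℝ V} {f g f' g' : V →ₗ[ℝ] V}
    (hφ : IsGivenBy φ S f g) (hψ : IsGivenBy ψ S' f' g')
    (h : ∀ y ∈ S', g' y ∈ B'' ↔ ∃ x ∈ S, f' y - g x ∈ B') : Function.Exact φ ψ := by
  intro c
  obtain ⟨y, hy, hfy, rfl⟩ := hψ.exists_rep c
  obtain ⟨_, hgy, hy'⟩ := hψ.map_rep y hy
  rw [hy', SubQuot.cls_eq_zero_iff, h y hy]
  constructor
  · rintro ⟨x, hx, hxy⟩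
    obtain ⟨hfx, hgx, hx'⟩ := hφ.map_rep x hx
    exact ⟨_, hx'.trans ((SubQuot.cls_eq_iff hfy hgx).2 hxy).symm⟩
  · rintro ⟨b, hb⟩
    obtain ⟨x, hx, hfx, rfl⟩ := hφ.exists_rep b
    obtain ⟨_, hgx, hx'⟩ := hφ.map_rep x hx
    exact ⟨x, hx, (SubQuot.cls_eq_iff hfy hgx).1 (hb.symm.trans hx')⟩

theorem IsGivenBy.surjective {φ : SubQuot A B →ₗ[ℝ] SubQuot A' B'} {S : Submodule ℝ V}
    {f g : V →ₗ[ℝ] V} (hφ : IsGivenBy φ S f g) (h : ∀ y ∈ A', ∃ x ∈ S, g x = y) :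
    Function.Surjective φ := by
  intro c
  obtain ⟨⟨a, ha⟩, rfl⟩ := (B'.submoduleOf A').mkQ_surjective c
  obtain ⟨x, hx, rfl⟩ := h a ha
  obtain ⟨hfx, hgx, hx'⟩ := hφ.map_rep x hx
  exact ⟨_, hx'⟩

end SubQuot

/-! ### The first page of the spectral sequence. -/

section Page

variable {m : ℕ} {M : Type*} [TopologicalSpace M] [ChartedSpace (Model m) M]

theorem filt_natCast (ω : Form m M 2) {p : ℕ} {i : ℤ} (h : i = p) :
    filt ω i = LinearMap.range (lef ω ^ p) := by
  rw [filt, h, Int.toNat_natCast]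

variable [IsManifold (𝓡 m) (⊤ : ℕ∞) M]

/-- The denominator of `E₁^{p,q}`. -/
abbrev pageBoundary (ω : Form m M 2) (θ : Form m M 1) (k r p q : ℤ) : Submodule ℝ (Forms m M) :=
  cyc ω θ k (r - 1) (p + 1) (q - 1) ⊔ (cyc ω θ k (r - 1) (p - r + 1) (q + r - 2)).map (lich θ k)

theorem mem_cyc_one {ω : Form m M 2} {θ : Form m M 1} {l k p' q : ℤ} {p : ℕ} (h : k + p = q)
    (hl : p' = p) {α : Forms m M} :
    α ∈ cyc ω θ l 1 p' q ↔ ∃ β ∈ homog m M k, (lef ω ^ p) β = α ∧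
      lich θ l α ∈ LinearMap.range (lef ω ^ (p + 1)) := by
  rw [cyc, Submodule.mem_inf, Submodule.mem_inf, Submodule.mem_comap, filt_natCast ω hl,
    filt_natCast ω (p := p + 1) (by push_cast; omega)]
  constructor
  · rintro ⟨⟨h1, h2⟩, h3⟩
    obtain ⟨β, hβ, rfl⟩ := exists_homog_of_mem_range (k := k) (by omega) h2 h1
    exact ⟨β, hβ, rfl, h3⟩
  · rintro ⟨β, hβ, rfl, h3⟩
    exact ⟨⟨⟨β, rfl⟩, homog_of_eq (by omega) (lef_pow_mem_homog ω hβ p)⟩, h3⟩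

/-- For `r = 1` the cocycle conditions inside the denominator are void, since the differential
preserves the filtration. Commuting it past `L^p` then extracts a common factor `L^p` and shifts the
weight from `l + p` to `l`. -/
theorem mem_pageBoundary_one {n : ℕ} {M : Type*} [TopologicalSpace M]
    [ChartedSpace (Model (2 * n)) M] [IsManifold (𝓡 (2 * n)) (⊤ : ℕ∞) M]
    {ω : Form (2 * n) M 2} {θ : Form (2 * n) M 1} (hd : extD 2 ω = -wedgeOne θ 2 ω)
    {l k q : ℤ} {p : ℕ} (h : k + p = q) {α : Forms (2 * n) M} :
    α ∈ pageBoundary ω θ (l + p) 1 p q ↔ ∃ γ ∈ homog (2 * n) M (k - 2),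
      ∃ η ∈ homog (2 * n) M (k - 1), α = (lef ω ^ p) (lef ω γ + lich θ l η) := by
  rw [Submodule.mem_sup]
  simp only [Submodule.mem_map, cyc, Submodule.mem_inf, Submodule.mem_comap]
  rw [filt_natCast ω (p := p + 1) (i := (p : ℤ) + 1) (by push_cast; omega),
    filt_natCast ω (p := p + 1) (i := (p : ℤ) + 1 + (1 - 1)) (by push_cast; omega),
    filt_natCast ω (p := p) (i := (p : ℤ) - 1 + 1) (by omega),
    filt_natCast ω (p := p) (i := (p : ℤ) - 1 + 1 + (1 - 1)) (by omega)]
  constructor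
  · rintro ⟨a, ⟨⟨h1, h2⟩, -⟩, _, ⟨b, ⟨⟨h3, h4⟩, -⟩, rfl⟩, rfl⟩
    obtain ⟨γ, hγ, rfl⟩ := exists_homog_of_mem_range (k := k - 2) (by push_cast; omega) h2 h1
    obtain ⟨η, hη, rfl⟩ := exists_homog_of_mem_range (k := k - 1) (by omega) h4 h3
    exact ⟨γ, hγ, η, hη, by rw [lich_lef_pow hd, map_add, lef_pow_succ_apply]⟩
  · rintro ⟨γ, hγ, η, hη, rfl⟩
    refine ⟨(lef ω ^ (p + 1)) γ, ⟨⟨⟨γ, rfl⟩, ?_⟩, ⟨lich θ (l - 1) γ, ?_⟩⟩, _,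
      ⟨(lef ω ^ p) η, ⟨⟨⟨η, rfl⟩, ?_⟩, ⟨lich θ l η, ?_⟩⟩, rfl⟩, ?_⟩
    · exact homog_of_eq (by push_cast; omega) (lef_pow_mem_homog ω hγ (p + 1))
    · rw [← lich_lef_pow hd]
      congr 2
      push_cast
      ring
    · exact homog_of_eq (by omega) (lef_pow_mem_homog ω hη p)
    · rw [lich_lef_pow hd]
    · rw [lich_lef_pow hd, map_add, lef_pow_succ_apply]

end Page

/-! ### The diagram chase on representing forms. -/

section Sequence

variable {n : ℕ} {M : Type*} [TopologicalSpace M] [ChartedSpace (Model (2 * n)) M]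
  [IsManifold (𝓡 (2 * n)) (⊤ : ℕ∞) M] {ω : Form (2 * n) M 2} {θ : Form (2 * n) M 1}

theorem IsLCS.nondeg (hω : IsLCS ω θ) : Nondegenerate ω := hω.nondegenerate

/-- The cocycles of degree `k` of the Lichnerowicz complex. -/
abbrev cocycles (θ : Form (2 * n) M 1) (l k : ℤ) : Submodule ℝ (Forms (2 * n) M) :=
  LinearMap.ker (lich θ l) ⊓ homog (2 * n) M k

/-- The coboundaries of degree `k` of the Lichnerowicz complex. -/
abbrev coboundaries (θ : Form (2 * n) M 1) (l k : ℤ) : Submodule ℝ (Forms (2 * n) M) :=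
  (homog (2 * n) M (k - 1)).map (lich θ l)

/-- The forms of degree `k` annihilated by `d_l⁻`. -/
abbrev minusCocycles (ω : Form (2 * n) M 2) (θ : Form (2 * n) M 1) (l k : ℤ) :
    Submodule ℝ (Forms (2 * n) M) :=
  LinearMap.ker (dMinus ω θ l) ⊓ homog (2 * n) M k

variable {l i j k q : ℤ} {p : ℕ}

theorem mem_cocycles {α : Forms (2 * n) M} :
    α ∈ cocycles θ l k ↔ lich θ l α = 0 ∧ α ∈ homog (2 * n) M k := Iff.rfl

theorem mem_minusCocycles {α : Forms (2 * n) M} :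
    α ∈ minusCocycles ω θ l k ↔ dMinus ω θ l α = 0 ∧ α ∈ homog (2 * n) M k := Iff.rfl

theorem lich_lef_pow_succ (hω : IsLCS ω θ) (l : ℤ) (p : ℕ) (η : Forms (2 * n) M) :
    lich θ (l + p) ((lef ω ^ (p + 1)) η) = (lef ω ^ (p + 1)) (lich θ (l - 1) η) := by
  rw [← lich_lef_pow hω.d_form]
  congr 2
  push_cast
  ring

/-- `L` is injective on forms, in the way it is used on representatives in `E₁`. -/
theorem exists_eq_of_lef_pow_mem (hω : IsLCS ω θ) (h : k + p = q) (hq : q ≤ n)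
    {α : Forms (2 * n) M} (hα : α ∈ homog (2 * n) M k)
    (hB : (lef ω ^ p) α ∈ pageBoundary ω θ (l + p) 1 p q) :
    ∃ γ ∈ homog (2 * n) M (k - 2), ∃ η ∈ homog (2 * n) M (k - 1), α = lef ω γ + lich θ l η := by
  obtain ⟨γ, hγ, η, hη, he⟩ := (mem_pageBoundary_one hω.d_form h).1 hB
  refine ⟨γ, hγ, η, hη, ?_⟩
  have h1 : lef ω γ ∈ homog (2 * n) M k := homog_of_eq (by ring) (lef_mem_homog ω hγ)
  have h2 : lich θ l η ∈ homog (2 * n) M k := homog_of_eq (by ring) (lich_mem_homog θ l hη)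
  rw [← sub_eq_zero]
  exact eq_zero_of_lef_pow_eq_zero rfl hω.nondeg (r := p) (by omega)
    (sub_mem hα (add_mem h1 h2)) (by rw [map_sub, he, sub_self])

theorem lef_pow_mem_pageBoundary (hω : IsLCS ω θ) (h : k + p = q) {α γ η : Forms (2 * n) M}
    (hγ : γ ∈ homog (2 * n) M (k - 2)) (hη : η ∈ homog (2 * n) M (k - 1))
    (he : α = lef ω γ + lich θ l η) :
    (lef ω ^ p) α ∈ pageBoundary ω θ (l + p) 1 p q :=
  (mem_pageBoundary_one hω.d_form h).2 ⟨γ, hγ, η, hη, by rw [he]⟩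

theorem dMinus_lef_add_lich (hω : IsLCS ω θ) (hk : k ≤ n) {γ : Forms (2 * n) M}
    (hγ : γ ∈ homog (2 * n) M (k - 2)) (η : Forms (2 * n) M) :
    dMinus ω θ l (lef ω γ + lich θ l η) = lich θ (l - 1) γ := by
  rw [map_add, dMinus_lef hω.nondeg hω.d_form l (by omega) hγ,
    dMinus_of_lich_eq_zero (lich_lich hω.closed l η), add_zero]

/-! ### Cocycle conditions -/

theorem lef_mem_cocycles (hω : IsLCS ω θ) (h : i + 2 = j) {α : Forms (2 * n) M}
    (hα : α ∈ cocycles θ (l - 1) i) : lef ω α ∈ cocycles θ l j :=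
  mem_cocycles.2 ⟨by rw [lich_lef hω.d_form, (mem_cocycles.1 hα).1, map_zero],
    homog_of_eq h (lef_mem_homog ω hα.2)⟩

theorem lef_mem_coboundaries (hω : IsLCS ω θ) (h : i + 2 = j) {α : Forms (2 * n) M}
    (hα : α ∈ coboundaries θ (l - 1) i) : lef ω α ∈ coboundaries θ l j := by
  obtain ⟨η, hη, rfl⟩ := hα
  exact ⟨lef ω η, homog_of_eq (by omega) (lef_mem_homog ω hη), lich_lef hω.d_form l η⟩

theorem lef_mem_minusCocycles (hω : IsLCS ω θ) (h : i + 2 = j) {α : Forms (2 * n) M}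
    (hα : α ∈ cocycles θ (l - 1) i) : lef ω α ∈ minusCocycles ω θ l j :=
  ⟨dMinus_of_lich_eq_zero (lef_mem_cocycles hω h hα).1, (lef_mem_cocycles hω h hα).2⟩

theorem lef_pow_mem_cyc (hω : IsLCS ω θ) (h : k + p = q) {α : Forms (2 * n) M}
    (hα : α ∈ cocycles θ l k) : (lef ω ^ p) α ∈ cyc ω θ (l + p) 1 p q :=
  (mem_cyc_one h rfl).2 ⟨α, hα.2, rfl, by
    rw [lich_lef_pow hω.d_form, LinearMap.mem_ker.1 hα.1, map_zero]; exact zero_mem _⟩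

theorem lef_pow_mem_pageBoundary_of_mem (hω : IsLCS ω θ) (h : k + p = q) {α : Forms (2 * n) M}
    (hα : α ∈ coboundaries θ l k) : (lef ω ^ p) α ∈ pageBoundary ω θ (l + p) 1 p q := by
  obtain ⟨η, hη, rfl⟩ := hα
  exact lef_pow_mem_pageBoundary hω h (zero_mem _) hη (by rw [map_zero, zero_add])

theorem lich_eq_lef_dMinus (hω : IsLCS ω θ) (hk : k ≤ n) {x : Forms (2 * n) M}
    (hx : x ∈ homog (2 * n) M k) (hp : dPlus ω θ l x = 0) :
    lich θ l x = lef ω (dMinus ω θ l x) := by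
  have := (lich_eq_dPlus_add hω.nondeg θ l hk hx).2.2
  rwa [hp, zero_add] at this

theorem lef_pow_mem_cyc_of_dPlus (hω : IsLCS ω θ) (h : k + p = q) (hk : k ≤ n)
    {x : Forms (2 * n) M} (hx : x ∈ homog (2 * n) M k) (hp : dPlus ω θ l x = 0) :
    (lef ω ^ p) x ∈ cyc ω θ (l + p) 1 p q :=
  (mem_cyc_one h rfl).2 ⟨x, hx, rfl, dMinus ω θ l x, by
    rw [lich_lef_pow hω.d_form, lich_eq_lef_dMinus hω hk hx hp, lef_pow_succ_apply]⟩

/-- In filtration position `q = n` no condition on `d⁺ x` is needed, because `L^p` annihilates it.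
-/
theorem lef_pow_mem_cyc_top (hω : IsLCS ω θ) (h : k + p = n) {x : Forms (2 * n) M}
    (hx : x ∈ homog (2 * n) M k) : (lef ω ^ p) x ∈ cyc ω θ (l + p) 1 p n :=
  (mem_cyc_one h rfl).2 ⟨x, hx, rfl, dMinus ω θ l x, by
    rw [lich_lef_pow hω.d_form, lef_pow_lich_of_add_eq hω.nondeg θ l h hx]⟩

/-- `L d_{l-1} (d_l⁻ x) = d_l (L d_l⁻ x) = d_l (d_l x) = 0`, and `L` is injective in degree `k ≤ n -
1`. -/
theorem dMinus_mem_cocycles (hω : IsLCS ω θ) (h : i + 1 = k) (hk : k + 1 ≤ n)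
    {x : Forms (2 * n) M} (hx : x ∈ homog (2 * n) M k) (hp : dPlus ω θ l x = 0) :
    dMinus ω θ l x ∈ cocycles θ (l - 1) i := by
  have hm : dMinus ω θ l x ∈ homog (2 * n) M i :=
    homog_of_eq (by omega) (lich_eq_dPlus_add hω.nondeg θ l (by omega) hx).2.1
  refine ⟨?_, hm⟩
  refine eq_zero_of_lef_eq_zero hω.nondeg hk (homog_of_eq h (lich_mem_homog θ (l - 1) hm)) ?_
  rw [← lich_lef hω.d_form, ← lich_eq_lef_dMinus hω (by omega) hx hp, lich_lich hω.closed]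

/-- `L` may fail to be injective on `d_{l-1} (d_l⁻ x)` here, so only its image under `L^(p+1)` is
shown to vanish, which is precisely the criterion for `d_{l-1}⁻`. -/
theorem dMinus_mem_minusCocycles (hω : IsLCS ω θ) (h : i + 1 = k) (hk : k + p = n)
    {x : Forms (2 * n) M} (hx : x ∈ homog (2 * n) M k) :
    dMinus ω θ l x ∈ minusCocycles ω θ (l - 1) i := by
  have hm : dMinus ω θ l x ∈ homog (2 * n) M i :=
    homog_of_eq (by omega) (lich_eq_dPlus_add hω.nondeg θ l (by omega) hx).2.1
  refine mem_minusCocycles.2 ⟨?_, hm⟩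
  rw [dMinus_eq_zero_iff hω.nondeg θ (l - 1) (r := p + 1)
    (by push_cast; omega) hm, ← lich_lef_pow_succ hω, ← lef_pow_lich_of_add_eq hω.nondeg θ l hk hx,
    lich_lef_pow hω.d_form, lich_lich hω.closed, map_zero]

theorem dMinus_mem_coboundaries (hω : IsLCS ω θ) (h : i + 1 = k) (hq : k + p = q) (hn : q ≤ n)
    {x : Forms (2 * n) M} (hx : x ∈ homog (2 * n) M k)
    (hB : (lef ω ^ p) x ∈ pageBoundary ω θ (l + p) 1 p q) :
    dMinus ω θ l x ∈ coboundaries θ (l - 1) i := by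
  obtain ⟨γ, hγ, η, hη, rfl⟩ := exists_eq_of_lef_pow_mem hω hq hn hx hB
  exact ⟨γ, homog_of_eq (by omega) hγ, (dMinus_lef_add_lich hω (by omega) hγ η).symm⟩

/-- Classes in `E₁` are represented by powers of `L` applied to primitive forms. -/
theorem exists_prim_rep (hω : IsLCS ω θ) (h : k + p = q) {a : Forms (2 * n) M}
    (ha : a ∈ cyc ω θ (l + p) 1 p q) :
    ∃ x ∈ prim ω k, a - (lef ω ^ p) x ∈ pageBoundary ω θ (l + p) 1 p q ∧
      (q + 1 ≤ n → dPlus ω θ l x = 0) := by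
  obtain ⟨α, hα, rfl, hr⟩ := (mem_cyc_one h rfl).1 ha
  obtain ⟨hx, γ, hγ, he⟩ := exists_eq_primProj_add_lef hω.nondeg hα
  refine ⟨primProj ω α, hx, ?_, fun hn => ?_⟩
  · rw [← map_sub]
    refine lef_pow_mem_pageBoundary hω h hγ (zero_mem _) ?_
    rw [map_zero, add_zero, sub_eq_iff_eq_add']
    exact he
  · have h1 : dPlus ω θ l (primProj ω α) = dPlus ω θ l α := by
      conv_rhs => rw [he, map_add, dPlus_lef hω.nondeg hω.d_form, add_zero]
    -- Since `(k + 1) + p ≤ n`, the factor `L^p` can be cancelled from `L^p (d_l α) ∈ L^(p+1) Ω`;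
    -- hence `d_l α` is in the image of `L`. This is where `q < n` is needed.
    rw [lich_lef_pow hω.d_form] at hr
    have hd := lich_mem_homog θ l hα
    obtain ⟨γ', hγ', he'⟩ := exists_homog_of_mem_range (k := k - 1) (by push_cast; omega)
      (lef_pow_mem_homog ω hd p) hr
    have h2 : lich θ l α = lef ω γ' := by
      rw [← sub_eq_zero]
      refine eq_zero_of_lef_pow_eq_zero rfl hω.nondeg (by omega)
        (sub_mem hd (homog_of_eq (by ring) (lef_mem_homog ω hγ'))) (r := p) ?_
      rw [map_sub, ← lef_pow_succ_apply, he', sub_self]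
    rw [h1, dPlus, LinearMap.comp_apply, h2, primProj_lef hω.nondeg]

/-! ### Exactness on representatives -/

/-- Cancelling `L^p` gives `α = L γ + d_l η`; closedness of `α` yields `L d_{l-1} γ = 0`, and
injectivity of `L` in degree `k - 1` makes `γ` closed. -/
theorem lef_pow_mem_pageBoundary_iff (hω : IsLCS ω θ) (h : i + 2 = k) (hq : k + p = q)
    (hn : q ≤ n) {α : Forms (2 * n) M} (hα : α ∈ cocycles θ l k) :
    (lef ω ^ p) α ∈ pageBoundary ω θ (l + p) 1 p q ↔
      ∃ β ∈ cocycles θ (l - 1) i, α - lef ω β ∈ coboundaries θ l k := by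
  constructor
  · intro hB
    obtain ⟨γ, hγ, η, hη, rfl⟩ := exists_eq_of_lef_pow_mem hω hq hn hα.2 hB
    refine ⟨γ, mem_cocycles.2 ⟨?_, homog_of_eq (by omega) hγ⟩, η, hη, by abel⟩
    have h0 := (mem_cocycles.1 hα).1
    rw [map_add, lich_lich hω.closed, add_zero, lich_lef hω.d_form] at h0
    exact eq_zero_of_lef_eq_zero hω.nondeg (by omega) (lich_mem_homog θ (l - 1) hγ) h0
  · rintro ⟨β, hβ, η, hη, he⟩
    exact lef_pow_mem_pageBoundary hω hq (homog_of_eq (by omega) hβ.2) hη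
      (by rw [he, add_sub_cancel])

/-- If `d_l⁻ x = d_{l-1} η`, then `x - L η` is closed and represents the same class, as `L^(p+1) η`
is a boundary on the page. -/
theorem dMinus_mem_coboundaries_iff (hω : IsLCS ω θ) (h : i + 1 = k) (hq : k + p = q)
    (hn : q ≤ n) {x : Forms (2 * n) M} (hx : x ∈ homog (2 * n) M k) (hp : dPlus ω θ l x = 0) :
    dMinus ω θ l x ∈ coboundaries θ (l - 1) i ↔ ∃ α ∈ cocycles θ l k,
      (lef ω ^ p) x - (lef ω ^ p) α ∈ pageBoundary ω θ (l + p) 1 p q := by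
  constructor
  · rintro ⟨η, hη, he⟩
    have hη' : lef ω η ∈ homog (2 * n) M k := homog_of_eq (by omega) (lef_mem_homog ω hη)
    refine ⟨x - lef ω η, mem_cocycles.2 ⟨?_, sub_mem hx hη'⟩, ?_⟩
    · rw [map_sub, lich_eq_lef_dMinus hω (by omega) hx hp, lich_lef hω.d_form, he, sub_self]
    · rw [← map_sub, sub_sub_cancel]
      exact lef_pow_mem_pageBoundary hω hq (homog_of_eq (by omega) hη) (zero_mem _)
        (by rw [map_zero, add_zero])
  · rintro ⟨α, hα, hB⟩
    rw [← map_sub] at hB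
    have := dMinus_mem_coboundaries hω h hq hn (sub_mem hx hα.2) hB
    rwa [map_sub, dMinus_of_lich_eq_zero (mem_cocycles.1 hα).1, sub_zero] at this

/-- Write a primitive of `L β` as `x + L γ` with `x` its Lefschetz-primitive part; then `d_l x = L
(β - d_{l-1} γ)`, from which `d⁺ x = 0` and `d⁻ x` are read off. -/
theorem lef_mem_coboundaries_iff (hω : IsLCS ω θ) (h : i + 1 = k) (hj : k + 1 = j) (hk : k ≤ n)
    {β : Forms (2 * n) M} (hβ : β ∈ homog (2 * n) M i) :
    lef ω β ∈ coboundaries θ l j ↔ ∃ x ∈ prim ω k ⊓ LinearMap.ker (dPlus ω θ l),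
      β - dMinus ω θ l x ∈ coboundaries θ (l - 1) i := by
  constructor
  · rintro ⟨α, hα, he⟩
    obtain ⟨hx, γ, hγ, hαγ⟩ := exists_eq_primProj_add_lef hω.nondeg
      (homog_of_eq (show j - 1 = k by omega) hα)
    have hd : lich θ l (primProj ω α) = 0 + lef ω (β - lich θ (l - 1) γ) := by
      rw [eq_sub_of_add_eq hαγ.symm, map_sub, he, lich_lef hω.d_form, map_sub, zero_add]
    have hγ' : lich θ (l - 1) γ ∈ homog (2 * n) M i :=
      homog_of_eq (by omega) (lich_mem_homog θ (l - 1) hγ)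
    obtain ⟨h1, h2⟩ := dPlus_dMinus_of_eq hω.nondeg (zero_mem (prim ω 0)) (sub_mem hβ hγ')
      (by omega) hd
    refine ⟨primProj ω α, ⟨hx, h1⟩, γ, homog_of_eq (by omega) hγ, ?_⟩
    rw [h2, sub_sub_cancel]
  · rintro ⟨x, ⟨hx, hp⟩, η, hη, he⟩
    have hxk := prim_le_homog ω k hx
    refine ⟨x + lef ω η, homog_of_eq (show k = j - 1 by omega)
      (add_mem hxk (homog_of_eq (by omega) (lef_mem_homog ω hη))), ?_⟩
    rw [map_add, lich_eq_lef_dMinus hω hk hxk hp, lich_lef hω.d_form, he, ← map_add,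
      add_sub_cancel]

theorem lef_pow_primProj_mem_pageBoundary (hω : IsLCS ω θ) (hk : k + p = n)
    {α : Forms (2 * n) M} (hα : α ∈ coboundaries θ l k) :
    (lef ω ^ p) (primProj ω α) ∈ pageBoundary ω θ (l + p) 1 p n := by
  obtain ⟨η, hη, rfl⟩ := hα
  obtain ⟨-, γ, hγ, he⟩ := exists_eq_primProj_add_lef hω.nondeg
    (homog_of_eq (show k - 1 + 1 = k by ring) (lich_mem_homog θ l hη))
  refine lef_pow_mem_pageBoundary hω hk (neg_mem hγ) hη ?_
  rw [eq_sub_of_add_eq he.symm, map_neg]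
  abel

/-- Projecting changes `α` only by some `L γ₀`, so `α = L (γ + γ₀) + d_l η`; applying `d_l⁻` gives
`d_{l-1} (γ + γ₀) = 0`. -/
theorem lef_pow_primProj_mem_pageBoundary_iff (hω : IsLCS ω θ) (h : i + 2 = k) (hk : k + p = n)
    {α : Forms (2 * n) M} (hα : α ∈ minusCocycles ω θ l k) :
    (lef ω ^ p) (primProj ω α) ∈ pageBoundary ω θ (l + p) 1 p n ↔
      ∃ β ∈ cocycles θ (l - 1) i, α - lef ω β ∈ coboundaries θ l k := by
  obtain ⟨hx, γ₀, hγ₀, he⟩ := exists_eq_primProj_add_lef hω.nondeg hα.2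
  constructor
  · intro hB
    obtain ⟨γ, hγ, η, hη, he'⟩ :=
      exists_eq_of_lef_pow_mem hω hk le_rfl (prim_le_homog ω k hx) hB
    have hs : α = lef ω (γ + γ₀) + lich θ l η := by
      rw [he'] at he
      refine he.trans ?_
      rw [map_add]
      abel
    have hm := (mem_minusCocycles.1 hα).1
    rw [hs, dMinus_lef_add_lich hω (by omega) (add_mem hγ hγ₀)] at hm
    exact ⟨γ + γ₀, mem_cocycles.2 ⟨hm, homog_of_eq (by omega) (add_mem hγ hγ₀)⟩, η, hη,
      eq_sub_of_add_eq' hs.symm⟩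
  · rintro ⟨β, hβ, η, hη, he'⟩
    refine lef_pow_mem_pageBoundary hω hk (γ := β - γ₀) (η := η)
      (sub_mem (homog_of_eq (by omega) hβ.2) hγ₀) hη ?_
    rw [eq_sub_of_add_eq he.symm, he', map_sub]
    abel

theorem dMinus_mem_coboundaries_iff_top (hω : IsLCS ω θ) (h : i + 1 = k) (hk : k + p = n)
    {x : Forms (2 * n) M} (hx : x ∈ prim ω k) :
    dMinus ω θ l x ∈ coboundaries θ (l - 1) i ↔ ∃ α ∈ minusCocycles ω θ l k,
      (lef ω ^ p) x - (lef ω ^ p) (primProj ω α) ∈ pageBoundary ω θ (l + p) 1 p n := by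
  have hxk := prim_le_homog ω k hx
  constructor
  · rintro ⟨η, hη, he⟩
    have hη' : lef ω η ∈ homog (2 * n) M k := homog_of_eq (by omega) (lef_mem_homog ω hη)
    refine ⟨x - lef ω η, mem_minusCocycles.2 ⟨?_, sub_mem hxk hη'⟩, ?_⟩
    · rw [map_sub, dMinus_lef hω.nondeg hω.d_form l (by omega) hη, he, sub_self]
    · rw [sub_eq_add_neg x, ← map_neg, primProj_add_lef hω.nondeg hx, sub_self]
      exact zero_mem _
  · rintro ⟨α, hα, hB⟩
    rw [← map_sub] at hB
    obtain ⟨hp, γ, hγ, he⟩ := exists_eq_primProj_add_lef hω.nondeg hα.2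
    have := dMinus_mem_coboundaries hω h hk le_rfl (sub_mem hxk (prim_le_homog ω k hp)) hB
    have hm := (mem_minusCocycles.1 hα).1
    -- Replacing `α` by its primitive part alters `d⁻ α = 0` only by the coboundary `-d_{l-1} γ`,
    -- which is then discarded.
    rw [map_sub, eq_sub_of_add_eq he.symm, map_sub, hm, zero_sub, sub_neg_eq_add,
      dMinus_lef hω.nondeg hω.d_form l (by omega) hγ] at this
    have h' : lich θ (l - 1) γ ∈ coboundaries θ (l - 1) i := ⟨γ, homog_of_eq (by omega) hγ, rfl⟩
    exact (Submodule.add_mem_iff_left _ h').1 this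

/-- Every form of degree `n + p` is `L^p α`, and its differential is `L^(p+1) (d_l⁻ α)`. Cancelling
`L^(p+1)` in degree `n - p - 1` gives `y = d_l⁻ α`; passing to the primitive part of `α` costs a
coboundary. -/
theorem lef_pow_succ_mem_coboundaries_iff (hω : IsLCS ω θ) (h : i + 1 = k) (hk : k + p = n)
    (hj : n + p + 1 = j) {y : Forms (2 * n) M} (hy : y ∈ homog (2 * n) M i) :
    (lef ω ^ (p + 1)) y ∈ coboundaries θ (l + p) j ↔ ∃ x ∈ prim ω k,
      y - dMinus ω θ l x ∈ coboundaries θ (l - 1) i := by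
  constructor
  · rintro ⟨ζ, hζ, he⟩
    obtain ⟨α, hα, rfl⟩ := exists_lef_pow_eq rfl hω.nondeg hk
      (homog_of_eq (show j - 1 = n + p by omega) hζ)
    obtain ⟨hx, γ, hγ, hαγ⟩ := exists_eq_primProj_add_lef hω.nondeg hα
    rw [lich_lef_pow hω.d_form, lef_pow_lich_of_add_eq hω.nondeg θ l hk hα] at he
    have hm : dMinus ω θ l α ∈ homog (2 * n) M i :=
      homog_of_eq (by omega) (lich_eq_dPlus_add hω.nondeg θ l (by omega) hα).2.1
    have hy' : y = dMinus ω θ l α := by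
      rw [← sub_eq_zero]
      exact eq_zero_of_lef_pow_eq_zero rfl hω.nondeg (r := p + 1) (by push_cast; omega)
        (sub_mem hy hm) (by rw [map_sub, he, sub_self])
    refine ⟨primProj ω α, hx, γ, homog_of_eq (by omega) hγ, ?_⟩
    rw [hy', ← map_sub, sub_eq_of_eq_add' hαγ, dMinus_lef hω.nondeg hω.d_form l (by omega) hγ]
  · rintro ⟨x, hx, η, hη, he⟩
    have hxk := prim_le_homog ω k hx
    refine ⟨(lef ω ^ p) x + (lef ω ^ (p + 1)) η, add_mem
      (homog_of_eq (by omega) (lef_pow_mem_homog ω hxk p))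
      (homog_of_eq (by push_cast; omega) (lef_pow_mem_homog ω hη (p + 1))), ?_⟩
    rw [map_add, lich_lef_pow hω.d_form, lef_pow_lich_of_add_eq hω.nondeg θ l hk hxk,
      lich_lef_pow_succ hω, he, ← map_add, add_sub_cancel]

theorem lef_pow_succ_mem_cocycles (hω : IsLCS ω θ) (h : i + p + 1 = n) (hj : n + p + 1 = j)
    {y : Forms (2 * n) M} (hy : y ∈ minusCocycles ω θ (l - 1) i) :
    (lef ω ^ (p + 1)) y ∈ cocycles θ (l + p) j := by
  refine mem_cocycles.2 ⟨?_, homog_of_eq (by push_cast; omega) (lef_pow_mem_homog ω hy.2 (p + 1))⟩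
  rw [lich_lef_pow_succ hω]
  exact (dMinus_eq_zero_iff hω.nondeg θ (l - 1) (by push_cast; omega) hy.2).1
    (mem_minusCocycles.1 hy).1

theorem lef_pow_succ_mem_coboundaries (hω : IsLCS ω θ) (h : i + p + 1 = n) (hj : n + p + 1 = j)
    {y : Forms (2 * n) M} (hy : y ∈ coboundaries θ (l - 1) i) :
    (lef ω ^ (p + 1)) y ∈ coboundaries θ (l + p) j := by
  obtain ⟨η, hη, rfl⟩ := hy
  exact ⟨(lef ω ^ (p + 1)) η, homog_of_eq (by push_cast; omega) (lef_pow_mem_homog ω hη (p + 1)),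
    lich_lef_pow_succ hω l p η⟩

/-- Hard Lefschetz supplies the preimage, and closedness of its image is the criterion for `d⁻ y =
0`; surjectivity thus holds already on cocycles. -/
theorem exists_lef_pow_succ_eq (hω : IsLCS ω θ) (h : i + p + 1 = n) (hj : n + p + 1 = j)
    {ζ : Forms (2 * n) M} (hζ : ζ ∈ cocycles θ (l + p) j) :
    ∃ y ∈ minusCocycles ω θ (l - 1) i, (lef ω ^ (p + 1)) y = ζ := by
  obtain ⟨y, hy, rfl⟩ := exists_lef_pow_eq rfl hω.nondeg (k := i) (r := p + 1)
    (by push_cast; omega) (homog_of_eq (by push_cast; omega) hζ.2)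
  refine ⟨y, mem_minusCocycles.2 ⟨?_, hy⟩, rfl⟩
  rw [dMinus_eq_zero_iff hω.nondeg θ (l - 1) (r := p + 1) (by push_cast; omega) hy,
    ← lich_lef_pow_succ hω]
  exact (mem_cocycles.1 hζ).1

end Sequence

end LCS

end

/-! ### Assembly of the exact sequence. -/

theorem proposition4p6 (n : ℕ) {M : Type*} [TopologicalSpace M]
    [ChartedSpace (LCS.Model (2 * n)) M] [IsManifold (𝓡 (2 * n)) (⊤ : ℕ∞) M]
    (ω : LCS.Form (2 * n) M 2) (θ : LCS.Form (2 * n) M 1) (hω : LCS.IsLCS ω θ)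
    (l : ℤ) (p : ℕ) (hp : p + 1 ≤ n) :
    -- the maps of the long exact sequence
    ∃ (Lbar : ∀ i j : ℤ, i + 2 = j → (LCS.Coh θ (l - 1) i →ₗ[ℝ] LCS.Coh θ l j))
      (Lpbar : ∀ k q : ℤ, k + p = q → (LCS.Coh θ l k →ₗ[ℝ] LCS.Page ω θ (l + p) 1 p q))
      (δ : ∀ q k : ℤ, p ≤ q → q ≤ (n : ℤ) - 1 → q - (p + 1) = k →
        (LCS.Page ω θ (l + p) 1 p q →ₗ[ℝ] LCS.Coh θ (l - 1) k))
      -- the maps of its extension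
      (L' : LCS.Coh θ (l - 1) (n - (p + 2)) →ₗ[ℝ] LCS.CGroup ω θ l (n - p))
      (Lp' : LCS.CGroup ω θ l (n - p) →ₗ[ℝ] LCS.Page ω θ (l + p) 1 p n)
      (δn : LCS.Page ω θ (l + p) 1 p n →ₗ[ℝ] LCS.CGroup ω θ (l - 1) (n - (p + 1)))
      (Lp1 : LCS.CGroup ω θ (l - 1) (n - (p + 1)) →ₗ[ℝ] LCS.Coh θ (l + p) (n + p + 1)),
      -- how they act on representatives
      (∀ i j h, LCS.IsInducedBy (Lbar i j h) (LCS.lef ω)) ∧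
      (∀ k q h, LCS.IsInducedBy (Lpbar k q h) (LCS.lef ω ^ p)) ∧
      (∀ q k h₁ h₂ h₃, LCS.IsGivenBy (δ q k h₁ h₂ h₃)
        (LCS.prim ω (q - p) ⊓ LinearMap.ker (LCS.dPlus ω θ l)) (LCS.lef ω ^ p)
        (LCS.dMinus ω θ l)) ∧
      LCS.IsInducedBy L' (LCS.lef ω) ∧
      LCS.IsInducedBy Lp' ((LCS.lef ω ^ p) ∘ₗ LCS.primProj ω) ∧
      LCS.IsGivenBy δn (LCS.prim ω (n - p)) (LCS.lef ω ^ p) (LCS.dMinus ω θ l) ∧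
      LCS.IsInducedBy Lp1 (LCS.lef ω ^ (p + 1)) ∧
      -- exactness of the long exact sequence
      (∀ (i j q : ℤ) (h : i + 2 = j) (h' : j + p = q), p ≤ q → q ≤ n →
        Function.Exact (Lbar i j h) (Lpbar j q h')) ∧
      (∀ (j q k : ℤ) (h : j + p = q) (h₁ : p ≤ q) (h₂ : q ≤ (n : ℤ) - 1) (h₃ : q - (p + 1) = k),
        Function.Exact (Lpbar j q h) (δ q k h₁ h₂ h₃)) ∧
      (∀ (q k j : ℤ) (h₁ : p ≤ q) (h₂ : q ≤ (n : ℤ) - 1) (h₃ : q - (p + 1) = k) (h : k + 2 = j),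
        Function.Exact (δ q k h₁ h₂ h₃) (Lbar k j h)) ∧
      -- exactness of its extension
      Function.Exact (δ (n - 1) (n - (p + 2)) (by omega) le_rfl (by ring)) L' ∧
      Function.Exact L' Lp' ∧
      Function.Exact Lp' δn ∧
      Function.Exact δn Lp1 ∧
      Function.Surjective Lp1 := by
  choose Lbar hLbar using fun (i j : ℤ) (h : i + 2 = j) => LCS.exists_isInducedBy
    (fun _ hα => LCS.lef_mem_cocycles hω h hα)
    (fun _ _ hα => LCS.lef_mem_coboundaries (l := l) hω h hα)
  choose Lpbar hLpbar using fun (k q : ℤ) (h : k + p = q) => LCS.exists_isInducedBy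
    (fun _ hα => LCS.lef_pow_mem_cyc hω h hα)
    (fun _ _ hα => LCS.lef_pow_mem_pageBoundary_of_mem (l := l) hω h hα)
  choose δ hδ using fun (q k : ℤ) (h₁ : p ≤ q) (h₂ : q ≤ (n : ℤ) - 1) (h₃ : q - (p + 1) = k) =>
    LCS.exists_isGivenBy (S := LCS.prim ω (q - p) ⊓ LinearMap.ker (LCS.dPlus ω θ l))
      (f := LCS.lef ω ^ p) (g := LCS.dMinus ω θ l)
      (A := LCS.cyc ω θ (l + p) 1 p q) (B := LCS.pageBoundary ω θ (l + p) 1 p q)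
      (A' := LCS.cocycles θ (l - 1) k) (B' := LCS.coboundaries θ (l - 1) k)
      (fun x hx => LCS.lef_pow_mem_cyc_of_dPlus hω (by ring) (by omega)
        (LCS.prim_le_homog ω _ hx.1) hx.2)
      (fun x hx => LCS.dMinus_mem_cocycles hω (by omega) (by omega)
        (LCS.prim_le_homog ω _ hx.1) hx.2)
      (fun a ha => by
        obtain ⟨x, hx, hB, hp⟩ := LCS.exists_prim_rep (k := q - p) hω (by ring) ha
        exact ⟨x, ⟨hx, hp (by omega)⟩, hB⟩)
      (fun x hx hB => LCS.dMinus_mem_coboundaries (k := q - p) hω (by omega) (by ring) (by omega)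
        (LCS.prim_le_homog ω _ hx.1) hB)
  obtain ⟨L', hL'⟩ := LCS.exists_isInducedBy (A := LCS.cocycles θ (l - 1) (n - (p + 2)))
    (B := LCS.coboundaries θ (l - 1) (n - (p + 2))) (A' := LCS.minusCocycles ω θ l (n - p))
    (B' := LCS.coboundaries θ l (n - p)) (g := LCS.lef ω)
    (fun _ hα => LCS.lef_mem_minusCocycles hω (by ring) hα)
    (fun _ _ hα => LCS.lef_mem_coboundaries hω (by ring) hα)
  obtain ⟨Lp', hLp'⟩ := LCS.exists_isInducedBy (A := LCS.minusCocycles ω θ l (n - p))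
    (B := LCS.coboundaries θ l (n - p)) (A' := LCS.cyc ω θ (l + p) 1 p n)
    (B' := LCS.pageBoundary ω θ (l + p) 1 p n) (g := (LCS.lef ω ^ p) ∘ₗ LCS.primProj ω)
    (fun α hα => LCS.lef_pow_mem_cyc_top (k := n - p) hω (by ring) (LCS.prim_le_homog ω _
      (LCS.exists_eq_primProj_add_lef hω.nondeg hα.2).1))
    (fun _ _ hα => LCS.lef_pow_primProj_mem_pageBoundary hω (by ring) hα)
  obtain ⟨δn, hδn⟩ := LCS.exists_isGivenBy (S := LCS.prim ω (n - p))
    (f := LCS.lef ω ^ p) (g := LCS.dMinus ω θ l)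
    (A := LCS.cyc ω θ (l + p) 1 p n) (B := LCS.pageBoundary ω θ (l + p) 1 p n)
    (A' := LCS.minusCocycles ω θ (l - 1) (n - (p + 1)))
    (B' := LCS.coboundaries θ (l - 1) (n - (p + 1)))
    (fun x hx => LCS.lef_pow_mem_cyc_top (k := n - p) hω (by ring) (LCS.prim_le_homog ω _ hx))
    (fun x hx => LCS.dMinus_mem_minusCocycles (k := n - p) (p := p) hω (by ring) (by ring)
      (LCS.prim_le_homog ω _ hx))
    (fun a ha => by
      obtain ⟨x, hx, hB, -⟩ := LCS.exists_prim_rep (k := n - p) hω (by ring) ha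
      exact ⟨x, hx, hB⟩)
    (fun x hx hB => LCS.dMinus_mem_coboundaries (k := n - p) hω (by ring) (by ring) le_rfl
      (LCS.prim_le_homog ω _ hx) hB)
  obtain ⟨Lp1, hLp1⟩ := LCS.exists_isInducedBy
    (A := LCS.minusCocycles ω θ (l - 1) (n - (p + 1)))
    (B := LCS.coboundaries θ (l - 1) (n - (p + 1))) (A' := LCS.cocycles θ (l + p) (n + p + 1))
    (B' := LCS.coboundaries θ (l + p) (n + p + 1)) (g := LCS.lef ω ^ (p + 1))
    (fun _ hα => LCS.lef_pow_succ_mem_cocycles hω (by ring) rfl hα)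
    (fun _ _ hα => LCS.lef_pow_succ_mem_coboundaries hω (by ring) rfl hα)
  refine ⟨Lbar, Lpbar, δ, L', Lp', δn, Lp1, hLbar, hLpbar, hδ, hL', hLp', hδn, hLp1,
    fun i j q h h' _ h₂ => ?_, fun j q k h h₁ h₂ h₃ => ?_, fun q k j h₁ h₂ h₃ h => ?_,
    ?_, ?_, ?_, ?_, ?_⟩
  · exact (hLbar i j h).exact (hLpbar j q h') fun α hα =>
      LCS.lef_pow_mem_pageBoundary_iff hω h h' h₂ hα
  · exact (hLpbar j q h).exact (hδ q k h₁ h₂ h₃) fun x hx => by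
      obtain rfl : j = q - p := by omega
      exact LCS.dMinus_mem_coboundaries_iff hω (by omega) h (by omega)
        (LCS.prim_le_homog ω _ hx.1) hx.2
  · exact (hδ q k h₁ h₂ h₃).exact (hLbar k j h) fun β hβ =>
      LCS.lef_mem_coboundaries_iff hω (by omega) (by omega) (by omega) hβ.2
  -- `C` and `H` share the same denominator, so vanishing of `L β` in `C` is the condition already
  -- treated for `H`.
  · exact (hδ _ _ _ _ _).exact hL' fun β hβ =>
      LCS.lef_mem_coboundaries_iff hω (by ring) (by ring) (by omega) hβ.2
  · exact hL'.exact hLp' fun α hα =>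
      LCS.lef_pow_primProj_mem_pageBoundary_iff hω (by ring) (by ring) hα
  · exact hLp'.exact hδn fun x hx =>
      LCS.dMinus_mem_coboundaries_iff_top hω (by ring) (by ring) hx
  · exact hδn.exact hLp1 fun y hy =>
      LCS.lef_pow_succ_mem_coboundaries_iff hω (by ring) (by ring) rfl hy.2
  · exact hLp1.surjective fun ζ hζ => LCS.exists_lef_pow_succ_eq hω (by ring) rfl hζ
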